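/- Let $H$ be an elliptical distribution on $\mathbb R^2$, i.e. a probability distribution with Lebesgue density $|\Sigma|^{-1/2}g\{(z-\mu)^T\Sigma^{-1}(z-\mu)\}$ for some nonnegative measurable function $g$, some $\mu\in\mathbb R^2$ and some positive definite $\Sigma$. Assume that $H$ has finite second moment and that $\Sigma=\sigma^2\begin{pmatrix}1&\rho\\ \rho&1\end{pmatrix}$ with $\sigma>0$ (so $-1<\rho<1$). Let $z_1,z_2,\dots$ with $z_i=(x_i,y_i)^T$ be i.i.d. with law $H$, let $Z=(X,Y)^T\sim H$, and let $\hat\rho_g$ be the sample symmetric Gini correlation $$\hat\rho_g=\frac{\sum_{i<j\le n}\frac{(x_i-x_j)(y_i-y_j)}{\|z_i-z_j\|}}{\sqrt{\sum_{i<j\le n}\frac{(x_i-x_j)^2}{\|z_i-z_j\|}}\sqrt{\sum_{i<j\le n}\frac{(y_i-y_j)^2}{\|z_i-z_j\|}}}$$ (with $0/0=0$). For $x<1$ put $\mathrm{EK}(x)=\int_0^{\pi/2}(1-x\sin^2\theta)^{-1/2}d\theta$ and $\mathrm{EE}(x)=\int_0^{\pi/2}(1-x\sin^2\theta)^{1/2}d\theta$,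 and for $r\in[-1,1]$ put $k(r)=r$ if $r\in\{0,1,-1\}$ and $$k(r)=\frac1r+\frac{r-1}{r}\,\frac{\mathrm{EK}(\frac{2r}{r+1})}{\mathrm{EE}(\frac{2r}{r+1})}\quad\text{otherwise.}$$ Let $R(z)=(R_1(z),R_2(z))=\mathbb E\,s(z-Z)$ be the spatial rank function of $H$, where $s(z)=z/\|z\|$ and $s(0)=0$; let $T_1(H)=2\mathbb E XR_1(Z)$, $T_2(H)=2\mathbb E XR_2(Z)$, $T_3(H)=2\mathbb E YR_2(Z)$, and $\rho_g(H)=T_2/\sqrt{T_1T_3}$. For a functional $T$ let $\mathrm{IF}(z;T,H)=\lim_{\varepsilon\downarrow0}\{T((1-\varepsilon)H+\varepsilon\delta_z)-T(H)\}/\varepsilon$. Put $L_i=\mathrm{IF}(\cdot\,;T_i,H)$ and $v_g=\mathbb E[\mathrm{IF}(Z;\rho_g,H)^2]$. Then $k$ is a bijection of $[-1,1]$ onto itself, $\hat\rho_g\in[-1,1]$, $T_1,T_3>0$, and $\mathrm{IF}(\cdot\,;\rho_g,H)$, $L_1,L_2,L_3$ (and the influence function of $2\mathbb E YR_1(Z)$)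 exist and are square integrable with respect to $H$. The estimator $\hat\rho^g=k^{-1}(\hat\rho_g)$ is an asymptotically unbiased ($\mathbb E\hat\rho^g\to\rho$) and $\sqrt n$-consistent ($\sqrt n(\hat\rho^g-\rho)$ is bounded in probability) estimator of $\rho$. Moreover, $$\sqrt n(\hat\rho^g-\rho)\xrightarrow{d}N\bigl(0,[1/k'(\rho)]^2v_g\bigr)\quad\text{as }n\to\infty,$$ where $k$ is differentiable at $\rho$ with $k'(\rho)\neq0$; for $\rho\ne0$, with $\mathrm{EK}$ and $\mathrm{EE}$ evaluated at $\frac{2\rho}{\rho+1}$, $$k'(\rho)=\frac{-3(\rho+1)\mathrm{EE}^2+4\,\mathrm{EE}\,\mathrm{EK}+(\rho-1)\mathrm{EK}^2}{2(\rho+1)\rho^2\,\mathrm{EE}^2},$$ and $k'(0)=3/4$ (the limit of this expression at $0$). If $\rho\neq0$, then $T_2\ne0$ and $$v_g=\frac{\rho_g^2}{4}\Bigl(\frac{\mathbb E L_1^2}{T_1^2}+\frac{4\,\mathbb E L_2^2}{T_2^2}+\frac{\mathbb E L_3^2}{T_3^2}-\frac{4\,\mathbb E L_1L_2}{T_1T_2}+\frac{2\,\mathbb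 E L_1L_3}{T_1T_3}-\frac{4\,\mathbb E L_2L_3}{T_2T_3}\Bigr),$$ where $L_i$ stands for $L_i(Z)$. -/

import Mathlib

open MeasureTheory ProbabilityTheory Filter Topology
open scoped Matrix NNReal ENNReal

/-! ### Elliptical distributions -/

/-- The law `H` on `ℝ^d` is elliptical with location `m` and (positive definite) scatter matrix `S`:
it has the Lebesgue density `|S|^{-1/2} g((z - m)ᵀ S⁻¹ (z - m))` for some nonnegative measurable
density generating function `g`. -/
def IsElliptical {d : ℕ} (H : Measure (EuclideanSpace ℝ (Fin d)))
    (m : EuclideanSpace ℝ (Fin d)) (S : Matrix (Fin d) (Fin d) ℝ) : Prop :=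
  S.PosDef ∧ ∃ g : ℝ → ℝ≥0, Measurable g ∧
    H = volume.withDensity (fun z =>
      ENNReal.ofReal ((Real.sqrt S.det)⁻¹ * g ((z - m).ofLp ⬝ᵥ (S⁻¹ *ᵥ (z - m).ofLp))))

/-! ### Spatial rank, symmetric Gini covariance and symmetric Gini correlation -/

/-- Spatial sign `z / ‖z‖`, with value `0` at `0`. -/
noncomputable def spatialSign {d : ℕ} (z : EuclideanSpace ℝ (Fin d)) : EuclideanSpace ℝ (Fin d) :=
  ‖z‖⁻¹ • z

/-- Spatial rank `r(z, H) = E s(z - Z)` with `Z ∼ H`. -/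
noncomputable def spatialRank {d : ℕ} (H : Measure (EuclideanSpace ℝ (Fin d)))
    (z : EuclideanSpace ℝ (Fin d)) : EuclideanSpace ℝ (Fin d) :=
  ∫ w, spatialSign (z - w) ∂H

/-- Symmetric Gini covariance `2 E[Z_a R_b(Z)]` of the coordinates `a` and `b`, where
`R = (R_0, R_1)` is the spatial rank function of `H`. -/
noncomputable def giniCov (a b : Fin 2) (H : Measure (EuclideanSpace ℝ (Fin 2))) : ℝ :=
  2 * ∫ z, z a * (spatialRank H z) b ∂H

/-- Symmetric Gini correlation. -/
noncomputable def giniCorr (H : Measure (EuclideanSpace ℝ (Fin 2))) : ℝ :=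
  giniCov 0 1 H / (Real.sqrt (giniCov 0 0 H) * Real.sqrt (giniCov 1 1 H))

/-- Sum over `i < j < n` of `(z_{i,a} - z_{j,a}) (z_{i,b} - z_{j,b}) / ‖z_i - z_j‖`. -/
noncomputable def sampleGiniSum (a b : Fin 2) (z : ℕ → EuclideanSpace ℝ (Fin 2)) (n : ℕ) : ℝ :=
  ∑ j ∈ Finset.range n, ∑ i ∈ Finset.range j,
    (z i a - z j a) * (z i b - z j b) / ‖z i - z j‖

/-- Sample symmetric Gini correlation of `z 0, …, z (n - 1)`. -/
noncomputable def sampleGiniCorr (z : ℕ → EuclideanSpace ℝ (Fin 2)) (n : ℕ) : ℝ :=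
  sampleGiniSum 0 1 z n /
    (Real.sqrt (sampleGiniSum 0 0 z n) * Real.sqrt (sampleGiniSum 1 1 z n))

/-! ### Influence functions and the asymptotic variance of the sample Gini correlation -/

/-- The contaminated distribution `(1 - ε) H + ε δ_z`. -/
noncomputable def contaminate (H : Measure (EuclideanSpace ℝ (Fin 2)))
    (z : EuclideanSpace ℝ (Fin 2)) (ε : ℝ) : Measure (EuclideanSpace ℝ (Fin 2)) :=
  ENNReal.ofReal (1 - ε) • H + ENNReal.ofReal ε • Measure.dirac z

/-- `φ z` is the limit of `(T((1 - ε) H + ε δ_z) - T(H)) / ε` as `ε ↓ 0`, for every `z`. -/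
def HasInfluenceFunction (T : Measure (EuclideanSpace ℝ (Fin 2)) → ℝ)
    (H : Measure (EuclideanSpace ℝ (Fin 2))) (φ : EuclideanSpace ℝ (Fin 2) → ℝ) : Prop :=
  ∀ z, Tendsto (fun ε : ℝ => (T (contaminate H z ε) - T H) / ε) (𝓝[>] 0) (𝓝 (φ z))

/-- The influence function of `T` at `H` (meaningful when the limits exist). -/
noncomputable def influenceFunction (T : Measure (EuclideanSpace ℝ (Fin 2)) → ℝ)
    (H : Measure (EuclideanSpace ℝ (Fin 2))) (z : EuclideanSpace ℝ (Fin 2)) : ℝ :=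
  limUnder (𝓝[>] (0 : ℝ)) (fun ε : ℝ => (T (contaminate H z ε) - T H) / ε)

/-- `v_g = E[IF(Z; ρ_g, H)²]`. -/
noncomputable def giniAsympVar (H : Measure (EuclideanSpace ℝ (Fin 2))) : ℝ :=
  ∫ z, (influenceFunction giniCorr H z) ^ 2 ∂H

/-- The expansion of `v_g` through `T₁, T₂, T₃` (the Gini covariances of `(X, X)`, `(X, Y)`,
`(Y, Y)`) and their influence functions `L₁, L₂, L₃`. -/
noncomputable def giniAsympVarExpansion (H : Measure (EuclideanSpace ℝ (Fin 2))) : ℝ :=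
  let T₁ := giniCov 0 0 H
  let T₂ := giniCov 0 1 H
  let T₃ := giniCov 1 1 H
  let L₁ := influenceFunction (giniCov 0 0) H
  let L₂ := influenceFunction (giniCov 0 1) H
  let L₃ := influenceFunction (giniCov 1 1) H
  (giniCorr H) ^ 2 / 4 *
    (1 / T₁ ^ 2 * (∫ z, L₁ z ^ 2 ∂H) + 4 / T₂ ^ 2 * (∫ z, L₂ z ^ 2 ∂H)
      + 1 / T₃ ^ 2 * (∫ z, L₃ z ^ 2 ∂H)
      - 4 / (T₁ * T₂) * (∫ z, L₁ z * L₂ z ∂H)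
      + 2 / (T₁ * T₃) * (∫ z, L₁ z * L₃ z ∂H)
      - 4 / (T₂ * T₃) * (∫ z, L₂ z * L₃ z ∂H))

/-! ### The function `k`, its inverse and its derivative -/

/-- Complete elliptic integral of the first kind, as a function of the parameter `x < 1`
(the square of the modulus). -/
noncomputable def EK (x : ℝ) : ℝ :=
  ∫ θ in (0 : ℝ)..(Real.pi / 2), 1 / Real.sqrt (1 - x * Real.sin θ ^ 2)

/-- Complete elliptic integral of the second kind, as a function of the parameter `x < 1`
(the square of the modulus). -/
noncomputable def EE (x : ℝ) : ℝ :=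
  ∫ θ in (0 : ℝ)..(Real.pi / 2), Real.sqrt (1 - x * Real.sin θ ^ 2)

open Classical in
/-- The function `k` on `[-1, 1]`. -/
noncomputable def giniLink (ρ : ℝ) : ℝ :=
  if ρ = 0 ∨ ρ = 1 ∨ ρ = -1 then ρ
  else 1 / ρ + (ρ - 1) / ρ * (EK (2 * ρ / (ρ + 1)) / EE (2 * ρ / (ρ + 1)))

/-- The inverse of `k : [-1, 1] → [-1, 1]`. -/
noncomputable def giniLinkInv : ℝ → ℝ :=
  Function.invFunOn giniLink (Set.Icc (-1) 1)

open Classical in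
/-- The formula for `k'` on `(-1, 1)`; it is `0 / 0` at `ρ = 0`, where the value is its limit
`3 / 4`. -/
noncomputable def giniLinkDeriv (ρ : ℝ) : ℝ :=
  if ρ = 0 then 3 / 4
  else
    (-3 * (ρ + 1) * EE (2 * ρ / (ρ + 1)) ^ 2
        + 4 * EE (2 * ρ / (ρ + 1)) * EK (2 * ρ / (ρ + 1))
        + (ρ - 1) * EK (2 * ρ / (ρ + 1)) ^ 2)
      / (2 * (ρ + 1) * ρ ^ 2 * EE (2 * ρ / (ρ + 1)) ^ 2)

/-- The estimator `k⁻¹(ρ̂_g)` based on `z 0, …, z (n - 1)`. -/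
noncomputable def giniLinearCorrEst (z : ℕ → EuclideanSpace ℝ (Fin 2)) (n : ℕ) : ℝ :=
  giniLinkInv (sampleGiniCorr z n)

/-! ### `√n`-consistency -/

/-- The estimators `T n` are `√n`-consistent for `θ`: `√n (T n - θ)` is bounded in probability. -/
def IsRootNConsistent {Ω : Type*} [MeasurableSpace Ω] (P : Measure Ω) (T : ℕ → Ω → ℝ) (θ : ℝ) :
    Prop :=
  ∀ ε : ℝ, 0 < ε → ∃ M : ℝ, ∀ᶠ n : ℕ in atTop,
    P {ω | M < |Real.sqrt n * (T n ω - θ)|} ≤ ENNReal.ofReal ε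

/-!
The proof rests on two independent facts: the Gini correlation of an elliptical law is `k(ρ)`, and
the sample Gini covariances are U-statistics with a square integrable kernel.

*Identification of the limit.* By symmetrization, `giniCov a b H` is the mean of the kernel
`w_a w_b / ‖w‖` at `w = Z - Z'` (`giniCov_eq`). An elliptical law is invariant under the one-parameter
group of linear maps `A R_θ A⁻¹` (about its centre), where `A Aᵀ` is proportional to the scatter
matrix (`IsElliptical.measurePreserving`). Averaging the homogeneous kernel over this group, for fixed
`w`, replaces it by its mean over an ellipse times a positive factor that depends on `w` but not on
`a`, `b` (`integral_giniKernel_ellipRot`). The three means over the ellipse are, up to `√2`,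
`N(ρ) = ∫₀^π (ρ + cos φ) / √(1 + ρ cos φ)` and (twice) `D(ρ) = ∫₀^π √(1 + ρ cos φ)`, and `k = N / D`
on `[-1, 1]` by the substitution `φ = 2θ` (`giniLink_eq`). No polar coordinates or densities of
`Z - Z'` are needed.

*The link function.* With `K = ∫ 1 / √(1 + r cos)`, `C = ∫ cos / √(1 + r cos)` and
`S = ∫ sin² / (1 + r cos)^{3/2}`, one has `N' = (K + S) / 2`, `D' = C / 2`, `N = r K + C`,
`D = K + r C`, and `C = -r S / 2` by parts. Hence `2 D² k' = K² + K S - 3 C²`, which is positive since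
`|C| ≤ K` and `2 |C| < S` (`linkQuotDeriv_pos`). Thus `k` is strictly increasing and continuous, which
gives the bijection and the differentiability of `k⁻¹`.

*Influence functions.* Along `(1 - ε) H + ε δ_z` the Gini covariance is a quadratic polynomial in `ε`
(`giniCov_contaminate`), so its influence function is `2 φ - 2 T`, with `φ` the conditional mean of
the kernel; the influence function of the Gini correlation follows by the quotient rule.

*Asymptotics.* In the Hoeffding decomposition the sample Gini covariance minus `T` is the average of
the influence function `2 φ - 2 T` plus a degenerate U-statistic. Distinct pairs of a degenerate
kernel are orthogonal (`integral_sq_sum_degenerate`), so the latter has second moment `O(n⁻²)`. The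
delta method for `k⁻¹(T₂ / √(T₁ T₃))` and the central limit theorem for the influence function of the
Gini correlation then give the limit law; Chebyshev's inequality gives `√n`-consistency, and
boundedness of the estimator gives asymptotic unbiasedness.
-/

/-! ### The link function as a quotient of trigonometric integrals -/

/-- `∫₀^π √(1 + r cos φ) dφ`, the denominator of the link function. -/
noncomputable def linkDen (r : ℝ) : ℝ :=
  ∫ φ in (0 : ℝ)..Real.pi, Real.sqrt (1 + r * Real.cos φ)

/-- `∫₀^π (r + cos φ) / √(1 + r cos φ) dφ`, the numerator of the link function. -/
noncomputable def linkNum (r : ℝ) : ℝ :=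
  ∫ φ in (0 : ℝ)..Real.pi, (r + Real.cos φ) / Real.sqrt (1 + r * Real.cos φ)

/-- `∫₀^π 1 / √(1 + r cos φ) dφ`. -/
noncomputable def linkInvInt (r : ℝ) : ℝ :=
  ∫ φ in (0 : ℝ)..Real.pi, 1 / Real.sqrt (1 + r * Real.cos φ)

/-- `∫₀^π cos φ / √(1 + r cos φ) dφ`. -/
noncomputable def linkCosInt (r : ℝ) : ℝ :=
  ∫ φ in (0 : ℝ)..Real.pi, Real.cos φ / Real.sqrt (1 + r * Real.cos φ)

/-- `∫₀^π sin² φ / (1 + r cos φ)^{3/2} dφ`. -/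
noncomputable def linkSinInt (r : ℝ) : ℝ :=
  ∫ φ in (0 : ℝ)..Real.pi, Real.sin φ ^ 2 / Real.sqrt (1 + r * Real.cos φ) ^ 3

lemma one_add_mul_cos_pos {r : ℝ} (hr : |r| < 1) (φ : ℝ) : 0 < 1 + r * Real.cos φ := by
  have h : |r * Real.cos φ| < 1 := by
    rw [abs_mul]
    nlinarith [Real.abs_cos_le_one φ, abs_nonneg r, abs_nonneg (Real.cos φ)]
  linarith [(abs_lt.mp h).1]

lemma one_add_mul_cos_nonneg {r : ℝ} (hr : r ∈ Set.Icc (-1 : ℝ) 1) (φ : ℝ) :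
    0 ≤ 1 + r * Real.cos φ := by
  nlinarith [Real.neg_one_le_cos φ, Real.cos_le_one φ, hr.1, hr.2]

/-- On the open interval `(0, π)` the radicand stays positive even for `r = ±1`. -/
lemma one_add_mul_cos_pos_of_mem_Ioo {r φ : ℝ} (hr : r ∈ Set.Icc (-1 : ℝ) 1)
    (hφ : φ ∈ Set.Ioo 0 Real.pi) : 0 < 1 + r * Real.cos φ := by
  have h1 : Real.cos φ < 1 := by
    simpa using Real.cos_lt_cos_of_nonneg_of_le_pi le_rfl hφ.2.le hφ.1
  have h2 : -1 < Real.cos φ := by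
    simpa using Real.cos_lt_cos_of_nonneg_of_le_pi hφ.1.le le_rfl hφ.2
  rcases le_total 0 (Real.cos φ) with h | h <;> nlinarith [hr.1, hr.2]

lemma sqrt_one_add_mul_cos_ne {r : ℝ} (hr : |r| < 1) (φ : ℝ) :
    Real.sqrt (1 + r * Real.cos φ) ≠ 0 :=
  (Real.sqrt_pos.mpr (one_add_mul_cos_pos hr φ)).ne'

lemma linkDen_pos {r : ℝ} (hr : r ∈ Set.Icc (-1 : ℝ) 1) : 0 < linkDen r := by
  refine intervalIntegral.intervalIntegral_pos_of_pos_on ?_ ?_ Real.pi_pos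
  · exact (by fun_prop : Continuous fun φ => Real.sqrt (1 + r * Real.cos φ)).intervalIntegrable _ _
  · intro φ hφ
    exact Real.sqrt_pos.mpr (one_add_mul_cos_pos_of_mem_Ioo hr hφ)

lemma continuous_one_div_sqrt {r : ℝ} (hr : |r| < 1) :
    Continuous fun φ => 1 / Real.sqrt (1 + r * Real.cos φ) :=
  continuous_const.div (by fun_prop) (sqrt_one_add_mul_cos_ne hr)

lemma continuous_cos_div_sqrt {r : ℝ} (hr : |r| < 1) :
    Continuous fun φ => Real.cos φ / Real.sqrt (1 + r * Real.cos φ) :=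
  Real.continuous_cos.div (by fun_prop) (sqrt_one_add_mul_cos_ne hr)

lemma continuous_sin_sq_div_sqrt {r : ℝ} (hr : |r| < 1) :
    Continuous fun φ => Real.sin φ ^ 2 / Real.sqrt (1 + r * Real.cos φ) ^ 3 :=
  (by fun_prop : Continuous fun φ => Real.sin φ ^ 2).div (by fun_prop)
    (fun φ => pow_ne_zero _ (sqrt_one_add_mul_cos_ne hr φ))

lemma linkInvInt_pos {r : ℝ} (hr : |r| < 1) : 0 < linkInvInt r := by
  refine intervalIntegral.intervalIntegral_pos_of_pos_on
    ((continuous_one_div_sqrt hr).intervalIntegrable _ _) (fun φ _ => ?_) Real.pi_pos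
  exact one_div_pos.mpr (Real.sqrt_pos.mpr (one_add_mul_cos_pos hr φ))

lemma linkSinInt_pos {r : ℝ} (hr : |r| < 1) : 0 < linkSinInt r := by
  refine intervalIntegral.intervalIntegral_pos_of_pos_on
    ((continuous_sin_sq_div_sqrt hr).intervalIntegrable _ _) (fun φ hφ => ?_) Real.pi_pos
  exact div_pos (pow_pos (Real.sin_pos_of_mem_Ioo hφ) 2)
    (pow_pos (Real.sqrt_pos.mpr (one_add_mul_cos_pos hr φ)) 3)

lemma abs_linkCosInt_le {r : ℝ} (hr : |r| < 1) : |linkCosInt r| ≤ linkInvInt r := by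
  refine intervalIntegral.abs_integral_le_integral_abs Real.pi_pos.le |>.trans ?_
  refine intervalIntegral.integral_mono_on Real.pi_pos.le
    ((continuous_cos_div_sqrt hr).abs.intervalIntegrable _ _)
    ((continuous_one_div_sqrt hr).intervalIntegrable _ _) (fun φ _ => ?_)
  rw [abs_div, abs_of_nonneg (Real.sqrt_nonneg _)]
  gcongr
  exact Real.abs_cos_le_one φ

lemma linkNum_eq {r : ℝ} (hr : |r| < 1) : linkNum r = r * linkInvInt r + linkCosInt r := by
  rw [linkNum, linkInvInt, linkCosInt, ← intervalIntegral.integral_const_mul,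
    ← intervalIntegral.integral_add
      (((continuous_one_div_sqrt hr).const_mul r).intervalIntegrable _ _)
      ((continuous_cos_div_sqrt hr).intervalIntegrable _ _)]
  congr 1
  ext φ
  ring

lemma linkDen_eq {r : ℝ} (hr : |r| < 1) : linkDen r = linkInvInt r + r * linkCosInt r := by
  rw [linkDen, linkInvInt, linkCosInt, ← intervalIntegral.integral_const_mul,
    ← intervalIntegral.integral_add
      ((continuous_one_div_sqrt hr).intervalIntegrable _ _)
      (((continuous_cos_div_sqrt hr).const_mul r).intervalIntegrable _ _)]
  congr 1
  ext φ
  have h := sqrt_one_add_mul_cos_ne hr φ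
  have h2 := Real.sq_sqrt (one_add_mul_cos_pos hr φ).le
  field_simp
  linarith

/-- Integration by parts: `∫ cos / √(1 + r cos) = -(r / 2) ∫ sin² / (1 + r cos)^{3/2}`, because
`sin / √(1 + r cos)` vanishes at `0` and at `π`. -/
lemma linkCosInt_eq {r : ℝ} (hr : |r| < 1) : linkCosInt r = -(r / 2) * linkSinInt r := by
  have hd : ∀ φ ∈ Set.uIcc 0 Real.pi,
      HasDerivAt (fun φ => Real.sin φ / Real.sqrt (1 + r * Real.cos φ))
        (Real.cos φ / Real.sqrt (1 + r * Real.cos φ)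
          + r / 2 * (Real.sin φ ^ 2 / Real.sqrt (1 + r * Real.cos φ) ^ 3)) φ := by
    intro φ _
    have h0 := one_add_mul_cos_pos hr φ
    have h := sqrt_one_add_mul_cos_ne hr φ
    have h1 : HasDerivAt (fun φ => 1 + r * Real.cos φ) (r * -Real.sin φ) φ :=
      ((Real.hasDerivAt_cos φ).const_mul r).const_add 1
    refine HasDerivAt.congr_deriv ((Real.hasDerivAt_sin φ).div (h1.sqrt h0.ne') h) ?_
    field_simp
    ring
  have h := intervalIntegral.integral_eq_sub_of_hasDerivAt hd
    (((continuous_cos_div_sqrt hr).add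
      ((continuous_sin_sq_div_sqrt hr).const_mul (r / 2))).intervalIntegrable _ _)
  rw [intervalIntegral.integral_add ((continuous_cos_div_sqrt hr).intervalIntegrable _ _)
      (((continuous_sin_sq_div_sqrt hr).const_mul (r / 2)).intervalIntegrable _ _),
    intervalIntegral.integral_const_mul] at h
  simp only [Real.sin_pi, Real.sin_zero, zero_div, sub_zero] at h
  rw [linkCosInt, linkSinInt]
  linarith

/-- Differentiation under the integral sign for an integrand that is jointly continuous, with
jointly continuous derivative, on a compact rectangle. -/
lemma hasDerivAt_intervalIntegral_of_continuousOn {F F' : ℝ → ℝ → ℝ} {a b c d r : ℝ}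
    (hr : r ∈ Set.Ioo c d) (hF : ∀ x ∈ Set.Icc c d, Continuous (F x))
    (hF' : ContinuousOn (Function.uncurry F') (Set.Icc c d ×ˢ Set.univ))
    (hd : ∀ x ∈ Set.Icc c d, ∀ t, HasDerivAt (fun x => F x t) (F' x t) x) :
    HasDerivAt (fun x => ∫ t in a..b, F x t) (∫ t in a..b, F' r t) r := by
  have hs : Set.Icc c d ∈ 𝓝 r := Icc_mem_nhds hr.1 hr.2
  obtain ⟨B, hB⟩ := (isCompact_Icc.prod (isCompact_uIcc (a := a) (b := b)))
    |>.exists_bound_of_continuousOn (hF'.mono (Set.prod_mono le_rfl (Set.subset_univ _)))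
  have hcr : Continuous (F' r) := by
    rw [← continuousOn_univ]
    exact hF'.comp (f := fun t => (r, t)) (by fun_prop)
      (fun t _ => ⟨Set.Ioo_subset_Icc_self hr, trivial⟩)
  refine (intervalIntegral.hasDerivAt_integral_of_dominated_loc_of_deriv_le (bound := fun _ => B)
    hs ?_ ?_ hcr.aestronglyMeasurable ?_ (by simp) ?_).2
  · filter_upwards [hs] with x hx using (hF x hx).aestronglyMeasurable
  · exact (hF r (Set.Ioo_subset_Icc_self hr)).intervalIntegrable _ _
  · exact ae_of_all _ fun t ht x hx => hB (x, t) ⟨hx, Set.uIoc_subset_uIcc ht⟩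
  · exact ae_of_all _ fun t _ x hx => hd x hx t

lemma exists_Icc_subset_abs_lt_one {r : ℝ} (hr : |r| < 1) :
    ∃ q, r ∈ Set.Ioo (-q) q ∧ ∀ x ∈ Set.Icc (-q) q, |x| < 1 := by
  obtain ⟨q, hq1, hq2⟩ := exists_between hr
  exact ⟨q, abs_lt.mp hq1, fun x hx => (abs_le.mpr hx).trans_lt hq2⟩

lemma hasDerivAt_linkDen {r : ℝ} (hr : |r| < 1) :
    HasDerivAt linkDen (linkCosInt r / 2) r := by
  obtain ⟨q, hrq, hq⟩ := exists_Icc_subset_abs_lt_one hr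
  rw [linkCosInt, ← intervalIntegral.integral_div]
  refine hasDerivAt_intervalIntegral_of_continuousOn
    (F := fun x φ => Real.sqrt (1 + x * Real.cos φ))
    (F' := fun x φ => Real.cos φ / Real.sqrt (1 + x * Real.cos φ) / 2) hrq
    (fun x _ => by fun_prop) ?_ ?_
  · refine ContinuousOn.div_const (ContinuousOn.div (by fun_prop) (by fun_prop) ?_) _
    rintro ⟨x, φ⟩ ⟨hx, -⟩
    exact sqrt_one_add_mul_cos_ne (hq x hx) φ
  · intro x hx φ
    have h1 : HasDerivAt (fun x => 1 + x * Real.cos φ) (Real.cos φ) x := by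
      simpa using ((hasDerivAt_id x).mul_const (Real.cos φ)).const_add 1
    refine HasDerivAt.congr_deriv (h1.sqrt (one_add_mul_cos_pos (hq x hx) φ).ne') ?_
    field_simp

lemma hasDerivAt_linkNum {r : ℝ} (hr : |r| < 1) :
    HasDerivAt linkNum ((linkInvInt r + linkSinInt r) / 2) r := by
  obtain ⟨q, hrq, hq⟩ := exists_Icc_subset_abs_lt_one hr
  rw [linkInvInt, linkSinInt, ← intervalIntegral.integral_add
      ((continuous_one_div_sqrt hr).intervalIntegrable _ _)
      ((continuous_sin_sq_div_sqrt hr).intervalIntegrable _ _), ← intervalIntegral.integral_div]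
  refine hasDerivAt_intervalIntegral_of_continuousOn
    (F := fun x φ => (x + Real.cos φ) / Real.sqrt (1 + x * Real.cos φ))
    (F' := fun x φ => (1 / Real.sqrt (1 + x * Real.cos φ)
      + Real.sin φ ^ 2 / Real.sqrt (1 + x * Real.cos φ) ^ 3) / 2) hrq ?_ ?_ ?_
  · intro x hx
    exact Continuous.div (by fun_prop) (by fun_prop) (sqrt_one_add_mul_cos_ne (hq x hx))
  · refine ContinuousOn.div_const (ContinuousOn.add (ContinuousOn.div (by fun_prop) (by fun_prop) ?_)
      (ContinuousOn.div (by fun_prop) (by fun_prop) ?_)) _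
    · rintro ⟨x, φ⟩ ⟨hx, -⟩
      exact sqrt_one_add_mul_cos_ne (hq x hx) φ
    · rintro ⟨x, φ⟩ ⟨hx, -⟩
      exact pow_ne_zero _ (sqrt_one_add_mul_cos_ne (hq x hx) φ)
  · intro x hx φ
    have h0 := one_add_mul_cos_pos (hq x hx) φ
    have h := sqrt_one_add_mul_cos_ne (hq x hx) φ
    have h1 : HasDerivAt (fun x => 1 + x * Real.cos φ) (Real.cos φ) x := by
      simpa using ((hasDerivAt_id x).mul_const (Real.cos φ)).const_add 1
    refine HasDerivAt.congr_deriv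
      (((hasDerivAt_id x).add_const (Real.cos φ)).div (h1.sqrt h0.ne') h) ?_
    have h2 := Real.sq_sqrt h0.le
    have h3 := Real.sin_sq_add_cos_sq φ
    field_simp
    simp only [id]
    generalize Real.sqrt (1 + x * Real.cos φ) = s at *
    rw [h2]
    linear_combination -h3

/-- The derivative of the quotient `linkNum / linkDen`, in terms of integrals. -/
noncomputable def linkQuotDeriv (r : ℝ) : ℝ :=
  (linkInvInt r ^ 2 + linkInvInt r * linkSinInt r - 3 * linkCosInt r ^ 2) / (2 * linkDen r ^ 2)

lemma mem_Icc_of_abs_lt_one {r : ℝ} (hr : |r| < 1) : r ∈ Set.Icc (-1 : ℝ) 1 :=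
  ⟨(abs_lt.mp hr).1.le, (abs_lt.mp hr).2.le⟩

lemma hasDerivAt_linkNum_div_linkDen {r : ℝ} (hr : |r| < 1) :
    HasDerivAt (fun x => linkNum x / linkDen x) (linkQuotDeriv r) r := by
  have h := (linkDen_pos (mem_Icc_of_abs_lt_one hr)).ne'
  refine HasDerivAt.congr_deriv ((hasDerivAt_linkNum hr).div (hasDerivAt_linkDen hr) h) ?_
  rw [linkQuotDeriv, div_eq_div_iff (by positivity) (by positivity), linkNum_eq hr]
  have h1 := linkDen_eq hr
  have h2 := linkCosInt_eq hr
  generalize linkDen r = D at *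
  generalize linkCosInt r = c at *
  generalize linkInvInt r = K at *
  generalize linkSinInt r = S at *
  subst h1 h2
  ring

lemma linkQuotDeriv_pos {r : ℝ} (hr : |r| < 1) : 0 < linkQuotDeriv r := by
  have hD := linkDen_pos (mem_Icc_of_abs_lt_one hr)
  refine div_pos ?_ (by positivity)
  have hK := linkInvInt_pos hr
  have hS := linkSinInt_pos hr
  have h1 := abs_linkCosInt_le hr
  have h2 : 2 * |linkCosInt r| < linkSinInt r := by
    rw [linkCosInt_eq hr, abs_mul, abs_neg, abs_div, abs_of_pos hS, abs_two]
    nlinarith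
  rw [← sq_abs (linkCosInt r)]
  have h0 := abs_nonneg (linkCosInt r)
  nlinarith [mul_pos hK (sub_pos.mpr h2), mul_nonneg h0 (sub_nonneg.mpr h1)]

/-! ### Identification with complete elliptic integrals -/

/-- The double-angle substitution `φ = 2θ`. -/
lemma integral_zero_pi_eq (f : ℝ → ℝ) :
    ∫ φ in (0 : ℝ)..Real.pi, f φ = 2 * ∫ θ in (0 : ℝ)..(Real.pi / 2), f (2 * θ) := by
  rw [intervalIntegral.integral_comp_mul_left f two_ne_zero]
  simp [mul_div_cancel₀]

lemma sqrt_one_add_mul_cos_two_mul {r : ℝ} (hr : |r| < 1) (θ : ℝ) :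
    Real.sqrt (1 + r * Real.cos (2 * θ))
      = Real.sqrt (1 + r) * Real.sqrt (1 - 2 * r / (r + 1) * Real.sin θ ^ 2) := by
  have h : 0 < r + 1 := by linarith [(abs_lt.mp hr).1]
  rw [← Real.sqrt_mul (by linarith), Real.cos_two_mul, Real.cos_sq']
  congr 1
  field_simp
  ring

lemma linkDen_eq_EE {r : ℝ} (hr : |r| < 1) :
    linkDen r = 2 * (Real.sqrt (1 + r) * EE (2 * r / (r + 1))) := by
  rw [linkDen, integral_zero_pi_eq, EE]
  simp only [sqrt_one_add_mul_cos_two_mul hr, intervalIntegral.integral_const_mul]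

lemma linkInvInt_eq_EK {r : ℝ} (hr : |r| < 1) :
    linkInvInt r = 2 * ((Real.sqrt (1 + r))⁻¹ * EK (2 * r / (r + 1))) := by
  rw [linkInvInt, integral_zero_pi_eq, EK]
  simp only [sqrt_one_add_mul_cos_two_mul hr, one_div, mul_inv, intervalIntegral.integral_const_mul]

lemma EE_pos {r : ℝ} (hr : |r| < 1) : 0 < EE (2 * r / (r + 1)) := by
  have h := linkDen_pos (mem_Icc_of_abs_lt_one hr)
  rw [linkDen_eq_EE hr] at h
  have h' : 0 < Real.sqrt (1 + r) := Real.sqrt_pos.mpr (by linarith [(abs_lt.mp hr).1])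
  exact pos_of_mul_pos_right (pos_of_mul_pos_right h (by norm_num)) h'.le

lemma linkNum_zero : linkNum 0 = 0 := by
  simp [linkNum]

lemma linkNum_one : linkNum 1 = linkDen 1 := by
  simp [linkNum, linkDen, Real.div_sqrt]

lemma linkNum_neg_one : linkNum (-1) = -linkDen (-1) := by
  rw [linkNum, linkDen, ← intervalIntegral.integral_neg]
  congr 1
  ext φ
  rw [show -1 + Real.cos φ = -(1 + -1 * Real.cos φ) by ring, neg_div, Real.div_sqrt]

lemma giniLink_eq {r : ℝ} (hr : r ∈ Set.Icc (-1 : ℝ) 1) :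
    giniLink r = linkNum r / linkDen r := by
  rw [giniLink]
  split_ifs with h
  · have hD := (linkDen_pos hr).ne'
    rcases h with rfl | rfl | rfl
    · simp [linkNum_zero]
    · rw [linkNum_one, div_self hD]
    · rw [linkNum_neg_one, neg_div, div_self hD]
  · push Not at h
    have hr1 : |r| < 1 := abs_lt.mpr ⟨lt_of_le_of_ne hr.1 h.2.2.symm, lt_of_le_of_ne hr.2 h.2.1⟩
    have h0 := h.1
    have hE := (EE_pos hr1).ne'
    have h1 : 0 < 1 + r := by linarith [(abs_lt.mp hr1).1]
    have hs := Real.sqrt_pos.mpr h1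
    have hs2 := Real.sq_sqrt h1.le
    have hC : linkNum r = (linkDen r - (1 - r ^ 2) * linkInvInt r) / r := by
      rw [linkNum_eq hr1, linkDen_eq hr1]
      field_simp
      ring
    rw [hC, linkDen_eq_EE hr1, linkInvInt_eq_EK hr1]
    generalize EE (2 * r / (r + 1)) = E at *
    generalize EK (2 * r / (r + 1)) = K at *
    generalize Real.sqrt (1 + r) = s at *
    have hr2 : r = s ^ 2 - 1 := by linarith
    subst hr2
    field_simp
    ring

lemma linkQuotDeriv_zero : linkQuotDeriv 0 = 3 / 4 := by
  have hπ := Real.pi_pos.ne'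
  simp only [linkQuotDeriv, linkInvInt, linkSinInt, linkCosInt, linkDen, zero_mul, add_zero,
    Real.sqrt_one, one_pow, div_one, integral_sin_sq, integral_cos, intervalIntegral.integral_const]
  simp
  field_simp
  norm_num

lemma giniLinkDeriv_eq {r : ℝ} (hr : |r| < 1) : giniLinkDeriv r = linkQuotDeriv r := by
  rw [giniLinkDeriv]
  split_ifs with h0
  · rw [h0, linkQuotDeriv_zero]
  · have hE := (EE_pos hr).ne'
    have h1 : 0 < 1 + r := by linarith [(abs_lt.mp hr).1]
    have hs := Real.sqrt_pos.mpr h1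
    have hs2 := Real.sq_sqrt h1.le
    have hD := linkDen_eq hr
    have hC : linkCosInt r = (linkDen r - linkInvInt r) / r := by
      rw [hD]
      field_simp
      ring
    have hS : linkSinInt r = -2 * ((linkDen r - linkInvInt r) / r) / r := by
      rw [← hC, linkCosInt_eq hr]
      field_simp
    rw [linkQuotDeriv, hC, hS, linkDen_eq_EE hr, linkInvInt_eq_EK hr]
    have h2 : r + 1 ≠ 0 := by linarith
    generalize EE (2 * r / (r + 1)) = E at *
    generalize EK (2 * r / (r + 1)) = K at *
    generalize Real.sqrt (1 + r) = s at *
    have hr2 : r = s ^ 2 - 1 := by linarith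
    subst hr2
    rw [div_eq_div_iff (by positivity) (by positivity)]
    field_simp
    ring

lemma hasDerivAt_giniLink {r : ℝ} (hr : |r| < 1) : HasDerivAt giniLink (giniLinkDeriv r) r := by
  rw [giniLinkDeriv_eq hr]
  refine (hasDerivAt_linkNum_div_linkDen hr).congr_of_eventuallyEq ?_
  filter_upwards [Icc_mem_nhds (abs_lt.mp hr).1 (abs_lt.mp hr).2] with x hx using giniLink_eq hx

lemma giniLinkDeriv_pos {r : ℝ} (hr : |r| < 1) : 0 < giniLinkDeriv r := by
  rw [giniLinkDeriv_eq hr]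
  exact linkQuotDeriv_pos hr

/-! ### Monotonicity of the link function and its inverse -/

/-- The integrand of `linkNum` is bounded uniformly in `r` and `φ`, because
`|r + cos φ| ≤ 1 + r cos φ`. -/
lemma abs_linkNum_integrand_le {r : ℝ} (hr : r ∈ Set.Icc (-1 : ℝ) 1) (φ : ℝ) :
    |(r + Real.cos φ) / Real.sqrt (1 + r * Real.cos φ)| ≤ Real.sqrt 2 := by
  have h0 := one_add_mul_cos_nonneg hr φ
  have h1 : |r + Real.cos φ| ≤ 1 + r * Real.cos φ := by
    rw [abs_le]
    constructor <;> nlinarith [hr.1, hr.2, Real.neg_one_le_cos φ, Real.cos_le_one φ]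
  rw [abs_div, abs_of_nonneg (Real.sqrt_nonneg _)]
  calc |r + Real.cos φ| / Real.sqrt (1 + r * Real.cos φ)
      ≤ (1 + r * Real.cos φ) / Real.sqrt (1 + r * Real.cos φ) := by gcongr
    _ = Real.sqrt (1 + r * Real.cos φ) := Real.div_sqrt
    _ ≤ Real.sqrt 2 := by
        apply Real.sqrt_le_sqrt
        nlinarith [hr.1, hr.2, Real.neg_one_le_cos φ, Real.cos_le_one φ]

lemma continuousOn_linkNum : ContinuousOn linkNum (Set.Icc (-1) 1) := by
  intro r hr
  refine intervalIntegral.continuousWithinAt_of_dominated_interval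
    (bound := fun _ => Real.sqrt 2) ?_ ?_ (by simp) ?_
  · refine Eventually.of_forall fun x => Measurable.aestronglyMeasurable ?_
    fun_prop
  · filter_upwards [self_mem_nhdsWithin] with x hx
    exact ae_of_all _ fun φ _ => abs_linkNum_integrand_le hx φ
  · -- The endpoint `φ = π`, where the radicand may vanish, is a null set.
    have hne : ∀ᵐ φ : ℝ, φ ≠ Real.pi := by simp [ae_iff]
    filter_upwards [hne] with φ hφ hmem
    rw [Set.uIoc_of_le Real.pi_pos.le] at hmem
    have hpos := one_add_mul_cos_pos_of_mem_Ioo hr ⟨hmem.1, lt_of_le_of_ne hmem.2 hφ⟩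
    exact ContinuousAt.continuousWithinAt
      (ContinuousAt.div (by fun_prop) (by fun_prop) (Real.sqrt_pos.mpr hpos).ne')

lemma continuous_linkDen : Continuous linkDen :=
  intervalIntegral.continuous_parametric_intervalIntegral_of_continuous' (by fun_prop) 0 Real.pi

lemma continuousOn_giniLink : ContinuousOn giniLink (Set.Icc (-1) 1) :=
  (continuousOn_linkNum.div continuous_linkDen.continuousOn fun _ hr => (linkDen_pos hr).ne').congr
    fun _ hr => giniLink_eq hr

lemma strictMonoOn_giniLink : StrictMonoOn giniLink (Set.Icc (-1) 1) := by
  refine strictMonoOn_of_deriv_pos (convex_Icc _ _) continuousOn_giniLink fun r hr => ?_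
  rw [interior_Icc] at hr
  have h : |r| < 1 := abs_lt.mpr hr
  rw [(hasDerivAt_giniLink h).deriv]
  exact giniLinkDeriv_pos h

lemma giniLink_one : giniLink 1 = 1 := by simp [giniLink]

lemma giniLink_neg_one : giniLink (-1) = -1 := by simp [giniLink]

lemma giniLink_zero : giniLink 0 = 0 := by simp [giniLink]

lemma bijOn_giniLink : Set.BijOn giniLink (Set.Icc (-1) 1) (Set.Icc (-1) 1) := by
  refine ⟨fun r hr => ⟨?_, ?_⟩, strictMonoOn_giniLink.injOn, ?_⟩
  · rw [← giniLink_neg_one]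
    exact strictMonoOn_giniLink.monotoneOn (by simp) hr hr.1
  · rw [← giniLink_one]
    exact strictMonoOn_giniLink.monotoneOn hr (by simp) hr.2
  · have h := intermediate_value_Icc (by norm_num : (-1 : ℝ) ≤ 1) continuousOn_giniLink
    rwa [giniLink_one, giniLink_neg_one] at h

lemma giniLinkInv_mem {t : ℝ} (ht : t ∈ Set.Icc (-1 : ℝ) 1) :
    giniLinkInv t ∈ Set.Icc (-1 : ℝ) 1 :=
  Function.invFunOn_mem (bijOn_giniLink.surjOn ht)

lemma giniLink_giniLinkInv {t : ℝ} (ht : t ∈ Set.Icc (-1 : ℝ) 1) :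
    giniLink (giniLinkInv t) = t :=
  Function.invFunOn_eq (bijOn_giniLink.surjOn ht)

lemma giniLinkInv_giniLink {r : ℝ} (hr : r ∈ Set.Icc (-1 : ℝ) 1) :
    giniLinkInv (giniLink r) = r :=
  bijOn_giniLink.injOn.leftInvOn_invFunOn hr

lemma monotoneOn_giniLinkInv : MonotoneOn giniLinkInv (Set.Icc (-1) 1) := by
  intro s hs t ht hst
  rw [← strictMonoOn_giniLink.le_iff_le (giniLinkInv_mem hs) (giniLinkInv_mem ht),
    giniLink_giniLinkInv hs, giniLink_giniLinkInv ht]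
  exact hst

/-- The inverse link function composed with the projection to `[-1, 1]` is measurable, being
monotone. -/
lemma measurable_giniLinkInv_projIcc :
    Measurable fun t : ℝ =>
      giniLinkInv (Set.projIcc (-1 : ℝ) 1 (by norm_num) t) :=
  Monotone.measurable fun _ _ hst =>
    monotoneOn_giniLinkInv (Subtype.prop _) (Subtype.prop _) (Set.monotone_projIcc _ hst)

lemma giniLink_mem_Ioo {r : ℝ} (hr : |r| < 1) : giniLink r ∈ Set.Ioo (-1 : ℝ) 1 := by
  have h := abs_lt.mp hr
  constructor
  · conv_lhs => rw [← giniLink_neg_one]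
    exact strictMonoOn_giniLink (by simp) (mem_Icc_of_abs_lt_one hr) h.1
  · conv_rhs => rw [← giniLink_one]
    exact strictMonoOn_giniLink (mem_Icc_of_abs_lt_one hr) (by simp) h.2

lemma hasDerivAt_giniLinkInv {r : ℝ} (hr : |r| < 1) :
    HasDerivAt giniLinkInv (giniLinkDeriv r)⁻¹ (giniLink r) := by
  have hmem := giniLink_mem_Ioo hr
  have hnhds := Icc_mem_nhds hmem.1 hmem.2
  refine HasDerivAt.of_local_left_inverse (f := giniLink) ?_ ?_ (giniLinkDeriv_pos hr).ne' ?_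
  · refine continuousAt_of_monotoneOn_of_image_mem_nhds monotoneOn_giniLinkInv hnhds ?_
    rw [giniLinkInv_giniLink (mem_Icc_of_abs_lt_one hr)]
    refine mem_of_superset (Icc_mem_nhds (abs_lt.mp hr).1 (abs_lt.mp hr).2) fun x hx => ?_
    exact ⟨giniLink x, bijOn_giniLink.mapsTo hx, giniLinkInv_giniLink hx⟩
  · rw [giniLinkInv_giniLink (mem_Icc_of_abs_lt_one hr)]
    exact hasDerivAt_giniLink hr
  · filter_upwards [hnhds] with t ht using giniLink_giniLinkInv ht

/-! ### The Gini kernel and Gini covariances as double integrals -/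

/-- The kernel `w_a w_b / ‖w‖`; the Gini covariance of the coordinates `a` and `b` is its mean at
the difference of two independent observations. -/
noncomputable def giniKernel (a b : Fin 2) (w : EuclideanSpace ℝ (Fin 2)) : ℝ :=
  w a * w b / ‖w‖

lemma giniKernel_neg (a b : Fin 2) (w : EuclideanSpace ℝ (Fin 2)) :
    giniKernel a b (-w) = giniKernel a b w := by
  simp [giniKernel]

lemma giniKernel_sub_comm (a b : Fin 2) (z w : EuclideanSpace ℝ (Fin 2)) :
    giniKernel a b (z - w) = giniKernel a b (w - z) := by
  rw [← giniKernel_neg, neg_sub]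

lemma giniKernel_zero (a b : Fin 2) : giniKernel a b 0 = 0 := by
  simp [giniKernel]

lemma abs_coord_le_norm (a : Fin 2) (w : EuclideanSpace ℝ (Fin 2)) : |w a| ≤ ‖w‖ := by
  simpa using PiLp.norm_apply_le w a

lemma abs_giniKernel_le (a b : Fin 2) (w : EuclideanSpace ℝ (Fin 2)) :
    |giniKernel a b w| ≤ ‖w‖ := by
  rw [giniKernel, abs_div, abs_norm, abs_mul]
  refine div_le_of_le_mul₀ (norm_nonneg _) (norm_nonneg _) ?_
  exact mul_le_mul (abs_coord_le_norm a w) (abs_coord_le_norm b w) (abs_nonneg _) (norm_nonneg _)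

@[fun_prop]
lemma measurable_giniKernel (a b : Fin 2) : Measurable (giniKernel a b) := by
  unfold giniKernel
  fun_prop

/-- Conditional mean of the Gini kernel given one of the two observations. -/
noncomputable def giniProj (a b : Fin 2) (H : Measure (EuclideanSpace ℝ (Fin 2)))
    (z : EuclideanSpace ℝ (Fin 2)) : ℝ :=
  ∫ w, giniKernel a b (z - w) ∂H

section FiniteMeasure

variable {μ : Measure (EuclideanSpace ℝ (Fin 2))} [IsFiniteMeasure μ]

lemma integrable_giniKernel_sub (hμ : Integrable (fun z => ‖z‖) μ) (a b : Fin 2)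
    (z : EuclideanSpace ℝ (Fin 2)) : Integrable (fun w => giniKernel a b (z - w)) μ := by
  refine Integrable.mono' ((integrable_const ‖z‖).add hμ)
    (by fun_prop : Measurable fun w => giniKernel a b (z - w)).aestronglyMeasurable
    (ae_of_all _ fun w => ?_)
  exact (abs_giniKernel_le a b _).trans (norm_sub_le z w)

lemma integrable_giniKernel_prod (hμ : Integrable (fun z => ‖z‖) μ) (a b : Fin 2) :
    Integrable (fun p : EuclideanSpace ℝ (Fin 2) × EuclideanSpace ℝ (Fin 2) =>
      giniKernel a b (p.1 - p.2)) (μ.prod μ) := by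
  refine Integrable.mono' ((hμ.comp_fst μ).add (hμ.comp_snd μ)) ?_ (ae_of_all _ fun p => ?_)
  · exact (by fun_prop : Measurable fun p : EuclideanSpace ℝ (Fin 2) × EuclideanSpace ℝ (Fin 2) =>
      giniKernel a b (p.1 - p.2)).aestronglyMeasurable
  · exact (abs_giniKernel_le a b _).trans (norm_sub_le p.1 p.2)

lemma spatialRank_apply (z : EuclideanSpace ℝ (Fin 2)) (b : Fin 2) :
    spatialRank μ z b = ∫ w, (z - w) b / ‖z - w‖ ∂μ := by
  have hint : Integrable (fun w => spatialSign (z - w)) μ := by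
    refine Integrable.of_bound ?_ 1 (ae_of_all _ fun w => ?_)
    · unfold spatialSign
      exact Measurable.aestronglyMeasurable (by fun_prop)
    · rw [spatialSign, norm_smul, norm_inv, norm_norm]
      exact inv_mul_le_one
  have h := (EuclideanSpace.proj (𝕜 := ℝ) b).integral_comp_comm hint
  rw [spatialRank]
  refine Eq.trans h.symm (integral_congr_ae (ae_of_all _ fun w => ?_))
  simp [spatialSign, div_eq_inv_mul]

/-- Symmetrization in the two observations turns the definition of the Gini covariance into a
double integral of the Gini kernel. -/
lemma giniCov_eq (hμ : Integrable (fun z => ‖z‖) μ) (a b : Fin 2) :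
    giniCov a b μ = ∫ z, giniProj a b μ z ∂μ := by
  set f : EuclideanSpace ℝ (Fin 2) × EuclideanSpace ℝ (Fin 2) → ℝ :=
    fun p => p.1 a * ((p.1 - p.2) b / ‖p.1 - p.2‖) with hf
  have hfint : Integrable f (μ.prod μ) := by
    refine Integrable.mono' (hμ.comp_fst μ) ?_ (ae_of_all _ fun p => ?_)
    · exact Measurable.aestronglyMeasurable (by fun_prop)
    · rw [hf, Real.norm_eq_abs, abs_mul, abs_div, abs_norm]
      exact (mul_le_mul (abs_coord_le_norm a p.1)
        (div_le_one_of_le₀ (abs_coord_le_norm b _) (norm_nonneg _)) (by positivity)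
        (norm_nonneg _)).trans_eq (mul_one _)
  have h1 : ∫ z, z a * spatialRank μ z b ∂μ = ∫ p, f p ∂(μ.prod μ) := by
    rw [integral_prod _ hfint]
    simp_rw [spatialRank_apply, hf, integral_const_mul]
  have h2 : ∫ z, giniProj a b μ z ∂μ
      = ∫ p, giniKernel a b (p.1 - p.2) ∂(μ.prod μ) :=
    (integral_prod _ (integrable_giniKernel_prod hμ a b)).symm
  have h3 : ∫ p, f p ∂(μ.prod μ) = ∫ p, f p.swap ∂(μ.prod μ) := (integral_prod_swap f).symm
  have h4 : ∀ p, giniKernel a b (p.1 - p.2) = f p + f p.swap := by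
    intro p
    simp only [hf, giniKernel, Prod.fst_swap, Prod.snd_swap, norm_sub_rev p.2 p.1, PiLp.sub_apply]
    ring
  have h5 : Integrable (fun p => f p.swap) (μ.prod μ) := hfint.swap
  simp_rw [h2, h4]
  rw [integral_add hfint h5, ← h3, giniCov, h1]
  ring

@[fun_prop]
lemma measurable_giniProj (a b : Fin 2) : Measurable (giniProj a b μ) := by
  refine (StronglyMeasurable.integral_prod_right' (ν := μ)
    (f := fun p : EuclideanSpace ℝ (Fin 2) × EuclideanSpace ℝ (Fin 2) =>
      giniKernel a b (p.1 - p.2)) ?_).measurable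
  exact Measurable.stronglyMeasurable (by fun_prop)

end FiniteMeasure

/-! ### Influence functions -/

section Influence

variable {H : Measure (EuclideanSpace ℝ (Fin 2))}

lemma integral_contaminate {f : EuclideanSpace ℝ (Fin 2) → ℝ} (hf : Integrable f H)
    (z : EuclideanSpace ℝ (Fin 2)) {ε : ℝ} (h0 : 0 ≤ ε) (h1 : ε ≤ 1) :
    ∫ w, f w ∂(contaminate H z ε) = (1 - ε) * ∫ w, f w ∂H + ε * f z := by
  rw [contaminate, integral_add_measure (hf.smul_measure ENNReal.ofReal_ne_top)
      ((integrable_dirac (by simp)).smul_measure ENNReal.ofReal_ne_top),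
    integral_smul_measure, integral_smul_measure, integral_dirac,
    ENNReal.toReal_ofReal (by linarith), ENNReal.toReal_ofReal h0, smul_eq_mul, smul_eq_mul]

lemma integrable_contaminate {f : EuclideanSpace ℝ (Fin 2) → ℝ} (hf : Integrable f H)
    (z : EuclideanSpace ℝ (Fin 2)) (ε : ℝ) : Integrable f (contaminate H z ε) :=
  (hf.smul_measure ENNReal.ofReal_ne_top).add_measure
    ((integrable_dirac (by simp)).smul_measure ENNReal.ofReal_ne_top)

lemma HasInfluenceFunction.eq {T : Measure (EuclideanSpace ℝ (Fin 2)) → ℝ}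
    {φ : EuclideanSpace ℝ (Fin 2) → ℝ} (h : HasInfluenceFunction T H φ) :
    influenceFunction T H = φ :=
  funext fun z => (h z).limUnder_eq

variable [IsProbabilityMeasure H]

instance isFiniteMeasure_contaminate (z : EuclideanSpace ℝ (Fin 2)) (ε : ℝ) :
    IsFiniteMeasure (contaminate H z ε) := by
  have h1 := (Measure.smul_finite H (c := ENNReal.ofReal (1 - ε)) ENNReal.ofReal_ne_top)
  have h2 := (Measure.smul_finite (Measure.dirac z) (c := ENNReal.ofReal ε) ENNReal.ofReal_ne_top)
  unfold contaminate
  infer_instance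

lemma abs_giniProj_le (hH : Integrable (fun z => ‖z‖) H) (a b : Fin 2)
    (z : EuclideanSpace ℝ (Fin 2)) : |giniProj a b H z| ≤ ‖z‖ + ∫ w, ‖w‖ ∂H := by
  calc |giniProj a b H z| ≤ ∫ w, |giniKernel a b (z - w)| ∂H := abs_integral_le_integral_abs
    _ ≤ ∫ w, (‖z‖ + ‖w‖) ∂H := by
        refine integral_mono (integrable_giniKernel_sub hH a b z).abs
          ((integrable_const ‖z‖).add hH) fun w => ?_
        exact (abs_giniKernel_le a b _).trans (norm_sub_le z w)
    _ = ‖z‖ + ∫ w, ‖w‖ ∂H := by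
        rw [integral_add (integrable_const _) hH]
        simp

lemma integrable_giniProj (hH : Integrable (fun z => ‖z‖) H) (a b : Fin 2) :
    Integrable (giniProj a b H) H := by
  refine Integrable.mono' (hH.add (integrable_const (∫ w, ‖w‖ ∂H)))
    (measurable_giniProj a b).aestronglyMeasurable (ae_of_all _ fun z => ?_)
  exact abs_giniProj_le hH a b z

lemma giniCov_contaminate (hH : Integrable (fun z => ‖z‖) H) (a b : Fin 2)
    (z : EuclideanSpace ℝ (Fin 2)) {ε : ℝ} (h0 : 0 ≤ ε) (h1 : ε ≤ 1) :
    giniCov a b (contaminate H z ε)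
      = (1 - ε) ^ 2 * giniCov a b H + 2 * ε * (1 - ε) * giniProj a b H z := by
  have hproj : ∀ y, giniProj a b (contaminate H z ε) y
      = (1 - ε) * giniProj a b H y + ε * giniKernel a b (z - y) := by
    intro y
    rw [giniProj, integral_contaminate (integrable_giniKernel_sub hH a b y) z h0 h1,
      giniKernel_sub_comm a b y z]
    rfl
  have hi1 := (integrable_giniProj hH a b).const_mul (1 - ε)
  have hi2 := (integrable_giniKernel_sub hH a b z).const_mul ε
  rw [giniCov_eq (integrable_contaminate hH z ε), giniCov_eq hH]
  simp_rw [hproj]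
  rw [integral_contaminate (hi1.fun_add hi2) z h0 h1, integral_add hi1 hi2, integral_const_mul,
    integral_const_mul, sub_self, giniKernel_zero, ← giniProj]
  ring

/-- The influence function `2 φ - 2 T` of the Gini covariance `T`, where `φ` is the conditional mean
of the Gini kernel. -/
noncomputable def giniCovInfluence (a b : Fin 2) (H : Measure (EuclideanSpace ℝ (Fin 2)))
    (z : EuclideanSpace ℝ (Fin 2)) : ℝ :=
  2 * giniProj a b H z - 2 * giniCov a b H

/-- The influence function of the Gini correlation, by the quotient rule. -/
noncomputable def giniCorrInfluence (H : Measure (EuclideanSpace ℝ (Fin 2)))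
    (z : EuclideanSpace ℝ (Fin 2)) : ℝ :=
  giniCovInfluence 0 1 H z / (Real.sqrt (giniCov 0 0 H) * Real.sqrt (giniCov 1 1 H))
    - giniCorr H / 2 * (giniCovInfluence 0 0 H z / giniCov 0 0 H
      + giniCovInfluence 1 1 H z / giniCov 1 1 H)

/-- A one-sided difference quotient, from a function that agrees with the given one on `[0, 1]`. -/
lemma tendsto_slope_of_hasDerivAt {f g : ℝ → ℝ} {f' : ℝ} (hf : HasDerivAt f f' 0)
    (hfg : ∀ ε, 0 ≤ ε → ε ≤ 1 → g ε = f ε) :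
    Tendsto (fun ε : ℝ => (g ε - f 0) / ε) (𝓝[>] 0) (𝓝 f') := by
  have h := (hasDerivAt_iff_tendsto_slope.mp hf).mono_left
    (nhdsWithin_mono 0 (fun x (hx : 0 < x) => hx.ne'))
  refine h.congr' ?_
  filter_upwards [Ioo_mem_nhdsGT (zero_lt_one' ℝ)] with ε hε
  rw [hfg ε hε.1.le hε.2.le, slope_def_field, sub_zero]

lemma hasDerivAt_contaminate_path (T φ : ℝ) :
    HasDerivAt (fun ε : ℝ => (1 - ε) ^ 2 * T + 2 * ε * (1 - ε) * φ) (2 * φ - 2 * T) 0 := by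
  have h1 : HasDerivAt (fun ε : ℝ => 1 - ε) (-1) 0 := (hasDerivAt_id (0 : ℝ)).const_sub 1
  have h2 : HasDerivAt (fun ε : ℝ => 2 * ε) 2 0 := by
    simpa using (hasDerivAt_id (0 : ℝ)).const_mul 2
  refine (((h1.pow 2).mul_const T).add ((h2.mul h1).mul_const φ)).congr_deriv ?_
  simp
  ring

lemma hasInfluenceFunction_giniCov (hH : Integrable (fun z => ‖z‖) H) (a b : Fin 2) :
    HasInfluenceFunction (giniCov a b) H (giniCovInfluence a b H) := by
  intro z
  have h := tendsto_slope_of_hasDerivAt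
    (hasDerivAt_contaminate_path (giniCov a b H) (giniProj a b H z))
    (fun ε h0 h1 => giniCov_contaminate hH a b z h0 h1)
  simpa [giniCovInfluence] using h

lemma hasInfluenceFunction_giniCorr (hH : Integrable (fun z => ‖z‖) H)
    (h0 : 0 < giniCov 0 0 H) (h1 : 0 < giniCov 1 1 H) :
    HasInfluenceFunction giniCorr H (giniCorrInfluence H) := by
  intro z
  have hp : ∀ a b, HasDerivAt (fun ε : ℝ => (1 - ε) ^ 2 * giniCov a b H
      + 2 * ε * (1 - ε) * giniProj a b H z) (giniCovInfluence a b H z) 0 :=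
    fun a b => hasDerivAt_contaminate_path _ _
  have hs0 := Real.sqrt_pos.mpr h0
  have hs1 := Real.sqrt_pos.mpr h1
  have hd := (hp 0 1).div (((hp 0 0).sqrt (by simpa using h0.ne')).mul
    ((hp 1 1).sqrt (by simpa using h1.ne'))) (by simp [hs0.ne', hs1.ne'])
  have hd' := hd.congr_deriv (g' := giniCorrInfluence H z) ?_
  · have h := tendsto_slope_of_hasDerivAt hd' (g := fun ε => giniCorr (contaminate H z ε))
      (fun ε h0 h1 => by simp [giniCorr, giniCov_contaminate hH _ _ z h0 h1])
    simpa [giniCorr] using h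
  · have e0 := Real.sq_sqrt h0.le
    have e1 := Real.sq_sqrt h1.le
    simp only [giniCorrInfluence, giniCorr, sub_zero, one_pow, one_mul, mul_zero, zero_mul,
      add_zero, Pi.mul_apply]
    generalize Real.sqrt (giniCov 0 0 H) = s at *
    generalize Real.sqrt (giniCov 1 1 H) = t at *
    rw [← e0, ← e1]
    field_simp

lemma integral_giniCovInfluence (hH : Integrable (fun z => ‖z‖) H) (a b : Fin 2) :
    ∫ z, giniCovInfluence a b H z ∂H = 0 := by
  simp only [giniCovInfluence]
  rw [integral_sub ((integrable_giniProj hH a b).const_mul 2) (integrable_const _),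
    integral_const_mul, ← giniCov_eq hH]
  simp

lemma memLp_giniProj (hH : MemLp (fun z => ‖z‖) 2 H) (a b : Fin 2) :
    MemLp (giniProj a b H) 2 H := by
  refine (hH.add (memLp_const (∫ w, ‖w‖ ∂H))).mono (measurable_giniProj a b).aestronglyMeasurable
    (ae_of_all _ fun z => ?_)
  exact (abs_giniProj_le (hH.integrable (by norm_num)) a b z).trans (le_abs_self _)

lemma memLp_giniCovInfluence (hH : MemLp (fun z => ‖z‖) 2 H) (a b : Fin 2) :
    MemLp (giniCovInfluence a b H) 2 H :=
  ((memLp_giniProj hH a b).const_mul 2).sub (memLp_const _)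

lemma memLp_giniCorrInfluence (hH : MemLp (fun z => ‖z‖) 2 H) :
    MemLp (giniCorrInfluence H) 2 H := by
  have h0 := memLp_giniCovInfluence hH 0 0
  have h1 := memLp_giniCovInfluence hH 0 1
  have h2 := memLp_giniCovInfluence hH 1 1
  have h := (h1.mul_const (Real.sqrt (giniCov 0 0 H) * Real.sqrt (giniCov 1 1 H))⁻¹).sub
    (((h0.mul_const (giniCov 0 0 H)⁻¹).add (h2.mul_const (giniCov 1 1 H)⁻¹)).const_mul
      (giniCorr H / 2))
  simp only [← div_eq_mul_inv] at h
  exact h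

lemma integral_giniCorrInfluence (hH : Integrable (fun z => ‖z‖) H) :
    ∫ z, giniCorrInfluence H z ∂H = 0 := by
  have hi : ∀ a b, Integrable (giniCovInfluence a b H) H := fun a b =>
    ((integrable_giniProj hH a b).const_mul 2).sub (integrable_const _)
  simp only [giniCorrInfluence]
  rw [integral_sub ((hi 0 1).div_const _)
      ((((hi 0 0).div_const _).fun_add ((hi 1 1).div_const _)).const_mul _),
    integral_const_mul, integral_add ((hi 0 0).div_const _) ((hi 1 1).div_const _)]
  simp [integral_div, integral_giniCovInfluence hH]

/-- Squaring `IF(ρ_g) = ρ_g (L₂ / T₂ - L₁ / (2 T₁) - L₃ / (2 T₃))` and integrating. -/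
lemma integral_giniCorrInfluence_sq (hH : MemLp (fun z => ‖z‖) 2 H)
    (h0 : 0 < giniCov 0 0 H) (h1 : 0 < giniCov 1 1 H) (h2 : giniCov 0 1 H ≠ 0) :
    ∫ z, giniCorrInfluence H z ^ 2 ∂H
      = (giniCorr H) ^ 2 / 4 *
        (1 / giniCov 0 0 H ^ 2 * (∫ z, giniCovInfluence 0 0 H z ^ 2 ∂H)
          + 4 / giniCov 0 1 H ^ 2 * (∫ z, giniCovInfluence 0 1 H z ^ 2 ∂H)
          + 1 / giniCov 1 1 H ^ 2 * (∫ z, giniCovInfluence 1 1 H z ^ 2 ∂H)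
          - 4 / (giniCov 0 0 H * giniCov 0 1 H)
            * (∫ z, giniCovInfluence 0 0 H z * giniCovInfluence 0 1 H z ∂H)
          + 2 / (giniCov 0 0 H * giniCov 1 1 H)
            * (∫ z, giniCovInfluence 0 0 H z * giniCovInfluence 1 1 H z ∂H)
          - 4 / (giniCov 0 1 H * giniCov 1 1 H)
            * (∫ z, giniCovInfluence 0 1 H z * giniCovInfluence 1 1 H z ∂H)) := by
  have hs0 := Real.sqrt_pos.mpr h0
  have hs1 := Real.sqrt_pos.mpr h1
  have hL := memLp_giniCovInfluence hH
  have hpt : ∀ z, giniCorrInfluence H z ^ 2 = (giniCorr H) ^ 2 / 4 *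
        (1 / giniCov 0 0 H ^ 2 * (giniCovInfluence 0 0 H z ^ 2)
          + 4 / giniCov 0 1 H ^ 2 * (giniCovInfluence 0 1 H z ^ 2)
          + 1 / giniCov 1 1 H ^ 2 * (giniCovInfluence 1 1 H z ^ 2)
          - 4 / (giniCov 0 0 H * giniCov 0 1 H)
            * (giniCovInfluence 0 0 H z * giniCovInfluence 0 1 H z)
          + 2 / (giniCov 0 0 H * giniCov 1 1 H)
            * (giniCovInfluence 0 0 H z * giniCovInfluence 1 1 H z)
          - 4 / (giniCov 0 1 H * giniCov 1 1 H)
            * (giniCovInfluence 0 1 H z * giniCovInfluence 1 1 H z)) := by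
    intro z
    rw [giniCorrInfluence, giniCorr]
    field_simp
    ring
  have i1 := ((hL 0 0).integrable_sq).const_mul (1 / giniCov 0 0 H ^ 2)
  have i2 := ((hL 0 1).integrable_sq).const_mul (4 / giniCov 0 1 H ^ 2)
  have i3 := ((hL 1 1).integrable_sq).const_mul (1 / giniCov 1 1 H ^ 2)
  have i4 := ((hL 0 0).integrable_mul (hL 0 1)).const_mul (4 / (giniCov 0 0 H * giniCov 0 1 H))
  have i5 := ((hL 0 0).integrable_mul (hL 1 1)).const_mul (2 / (giniCov 0 0 H * giniCov 1 1 H))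
  have i6 := ((hL 0 1).integrable_mul (hL 1 1)).const_mul (4 / (giniCov 0 1 H * giniCov 1 1 H))
  simp only [Pi.mul_apply] at i4 i5 i6
  simp_rw [hpt]
  rw [integral_const_mul, integral_sub ((((i1.fun_add i2).fun_add i3).sub' i4).fun_add i5) i6,
    integral_add (((i1.fun_add i2).fun_add i3).sub' i4) i5,
    integral_sub ((i1.fun_add i2).fun_add i3) i4,
    integral_add (i1.fun_add i2) i3, integral_add i1 i2]
  simp only [integral_const_mul]

end Influence

/-! ### Rotations of an ellipse -/

/-- The linear maps `A R_θ A⁻¹`, where `A Aᵀ` is proportional to `!![1, ρ; ρ, 1]` and `R_θ` is the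
rotation by the angle `θ`. They leave elliptical laws with this scatter matrix invariant. -/
noncomputable def ellipRot (ρ θ : ℝ) : Matrix (Fin 2) (Fin 2) ℝ :=
  !![Real.cos θ + Real.sin θ * ρ / Real.sqrt (1 - ρ ^ 2), -(Real.sin θ / Real.sqrt (1 - ρ ^ 2));
    Real.sin θ / Real.sqrt (1 - ρ ^ 2), Real.cos θ - Real.sin θ * ρ / Real.sqrt (1 - ρ ^ 2)]

/-- The ellipse `A (cos θ, sin θ)`, where `A = !![√(1 + ρ), -√(1 - ρ); √(1 + ρ), √(1 - ρ)]`. -/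
noncomputable def ellipCircle (ρ θ : ℝ) : EuclideanSpace ℝ (Fin 2) :=
  !₂[Real.sqrt (1 + ρ) * Real.cos θ - Real.sqrt (1 - ρ) * Real.sin θ,
    Real.sqrt (1 + ρ) * Real.cos θ + Real.sqrt (1 - ρ) * Real.sin θ]

/-- The norm of `A⁻¹ w`, computed as that of a complex number. -/
noncomputable def ellipNorm (ρ : ℝ) (w : EuclideanSpace ℝ (Fin 2)) : ℝ :=
  ‖(((w 0 + w 1) / (2 * Real.sqrt (1 + ρ)) : ℝ) : ℂ)
    + ((w 1 - w 0) / (2 * Real.sqrt (1 - ρ)) : ℝ) * Complex.I‖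

lemma toEuclideanLin_apply_zero (M : Matrix (Fin 2) (Fin 2) ℝ) (w : EuclideanSpace ℝ (Fin 2)) :
    Matrix.toEuclideanLin M w 0 = M 0 0 * w 0 + M 0 1 * w 1 := by
  simp [Matrix.toEuclideanLin, Matrix.mulVec, dotProduct, Fin.sum_univ_two]

lemma toEuclideanLin_apply_one (M : Matrix (Fin 2) (Fin 2) ℝ) (w : EuclideanSpace ℝ (Fin 2)) :
    Matrix.toEuclideanLin M w 1 = M 1 0 * w 0 + M 1 1 * w 1 := by
  simp [Matrix.toEuclideanLin, Matrix.mulVec, dotProduct, Fin.sum_univ_two]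

lemma euclidean_ext {v w : EuclideanSpace ℝ (Fin 2)} (h0 : v 0 = w 0) (h1 : v 1 = w 1) : v = w := by
  ext i
  fin_cases i
  · exact h0
  · exact h1

section Ellipse

variable {ρ : ℝ}

lemma sqrt_one_sub_sq (hρ : |ρ| < 1) :
    Real.sqrt (1 - ρ ^ 2) = Real.sqrt (1 + ρ) * Real.sqrt (1 - ρ) := by
  rw [← Real.sqrt_mul (by linarith [(abs_lt.mp hρ).1])]
  congr 1
  ring

lemma sqrt_one_add_pos (hρ : |ρ| < 1) : 0 < Real.sqrt (1 + ρ) :=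
  Real.sqrt_pos.mpr (by linarith [(abs_lt.mp hρ).1])

lemma sqrt_one_sub_pos (hρ : |ρ| < 1) : 0 < Real.sqrt (1 - ρ) :=
  Real.sqrt_pos.mpr (by linarith [(abs_lt.mp hρ).2])

lemma det_ellipRot (hρ : |ρ| < 1) (θ : ℝ) : (ellipRot ρ θ).det = 1 := by
  have hs : 0 < Real.sqrt (1 - ρ ^ 2) := by
    rw [sqrt_one_sub_sq hρ]
    exact mul_pos (sqrt_one_add_pos hρ) (sqrt_one_sub_pos hρ)
  have hs2 := Real.sq_sqrt (Real.sqrt_pos.mp hs).le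
  have h := Real.sin_sq_add_cos_sq θ
  rw [ellipRot, Matrix.det_fin_two_of]
  generalize Real.sqrt (1 - ρ ^ 2) = s at *
  field_simp
  linear_combination s ^ 2 * h - Real.sin θ ^ 2 * hs2

lemma ellipRot_smul_ellipCircle (hρ : |ρ| < 1) (θ α r : ℝ) :
    Matrix.toEuclideanLin (ellipRot ρ θ) (r • ellipCircle ρ α) = r • ellipCircle ρ (θ + α) := by
  have hp := sqrt_one_add_pos hρ
  have hq := sqrt_one_sub_pos hρ
  have hp2 := Real.sq_sqrt (Real.sqrt_pos.mp hp).le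
  have hq2 := Real.sq_sqrt (Real.sqrt_pos.mp hq).le
  apply euclidean_ext
  · simp only [toEuclideanLin_apply_zero, ellipRot, ellipCircle, sqrt_one_sub_sq hρ,
      Real.cos_add, Real.sin_add, Matrix.of_apply, Matrix.cons_val', Matrix.cons_val_zero,
      Matrix.cons_val_one, PiLp.smul_apply, smul_eq_mul, Matrix.cons_val_fin_one]
    generalize Real.sqrt (1 + ρ) = p at *
    generalize Real.sqrt (1 - ρ) = q at *
    have h1 : ρ = p ^ 2 - 1 := by linarith
    have h2 : q ^ 2 = 2 - p ^ 2 := by linarith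
    subst h1
    field_simp
    linear_combination
      (r * Real.sin θ * Real.cos α * p) * h2
  · simp only [toEuclideanLin_apply_one, ellipRot, ellipCircle, sqrt_one_sub_sq hρ,
      Real.cos_add, Real.sin_add, Matrix.of_apply, Matrix.cons_val', Matrix.cons_val_zero,
      Matrix.cons_val_one, PiLp.smul_apply, smul_eq_mul, Matrix.cons_val_fin_one]
    generalize Real.sqrt (1 + ρ) = p at *
    generalize Real.sqrt (1 - ρ) = q at *
    have h1 : ρ = p ^ 2 - 1 := by linarith
    have h2 : q ^ 2 = 2 - p ^ 2 := by linarith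
    subst h1
    field_simp
    linear_combination
      (-(r * Real.sin θ * Real.cos α * p)) * h2

lemma exists_eq_ellipNorm_smul (hρ : |ρ| < 1) (w : EuclideanSpace ℝ (Fin 2)) :
    ∃ α, w = ellipNorm ρ w • ellipCircle ρ α := by
  have hp := sqrt_one_add_pos hρ
  have hq := sqrt_one_sub_pos hρ
  set u : ℂ := (((w 0 + w 1) / (2 * Real.sqrt (1 + ρ)) : ℝ) : ℂ)
    + ((w 1 - w 0) / (2 * Real.sqrt (1 - ρ)) : ℝ) * Complex.I with hu
  have hc := Complex.norm_mul_cos_arg u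
  have hs := Complex.norm_mul_sin_arg u
  have hre : u.re = (w 0 + w 1) / (2 * Real.sqrt (1 + ρ)) := by
    simp only [hu, Complex.add_re, Complex.re_ofReal_mul, Complex.I_re, Complex.ofReal_re, mul_zero,
      add_zero]
  have him : u.im = (w 1 - w 0) / (2 * Real.sqrt (1 - ρ)) := by
    simp only [hu, Complex.add_im, Complex.im_ofReal_mul, Complex.I_im, Complex.ofReal_im, mul_one,
      zero_add]
  rw [hre, eq_div_iff (by positivity)] at hc
  rw [him, eq_div_iff (by positivity)] at hs
  refine ⟨u.arg, euclidean_ext ?_ ?_⟩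
  · simp only [ellipNorm, ← hu, ellipCircle, PiLp.smul_apply, smul_eq_mul, Matrix.cons_val_zero]
    linear_combination (-(1 : ℝ) / 2) * hc + (1 / 2 : ℝ) * hs
  · simp only [ellipNorm, ← hu, ellipCircle, PiLp.smul_apply, smul_eq_mul, Matrix.cons_val_one,
      Matrix.cons_val_fin_one]
    linear_combination (-(1 : ℝ) / 2) * hc - (1 / 2 : ℝ) * hs

lemma ellipNorm_nonneg (w : EuclideanSpace ℝ (Fin 2)) : 0 ≤ ellipNorm ρ w := norm_nonneg _

@[fun_prop]
lemma continuous_ellipNorm : Continuous (ellipNorm ρ) := by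
  unfold ellipNorm
  fun_prop

lemma eq_zero_of_ellipNorm_eq_zero (hρ : |ρ| < 1) {w : EuclideanSpace ℝ (Fin 2)}
    (h : ellipNorm ρ w = 0) : w = 0 := by
  obtain ⟨α, hα⟩ := exists_eq_ellipNorm_smul hρ w
  rw [hα, h, zero_smul]

lemma ellipNorm_le (hρ : |ρ| < 1) (w : EuclideanSpace ℝ (Fin 2)) :
    ellipNorm ρ w ≤ ((Real.sqrt (1 + ρ))⁻¹ + (Real.sqrt (1 - ρ))⁻¹) * ‖w‖ := by
  have hp := sqrt_one_add_pos hρ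
  have hq := sqrt_one_sub_pos hρ
  have h0 := abs_coord_le_norm 0 w
  have h1 := abs_coord_le_norm 1 w
  have h2 : |w 0 + w 1| ≤ 2 * ‖w‖ := (abs_add_le _ _).trans (by linarith)
  have h3 : |w 1 - w 0| ≤ 2 * ‖w‖ := (abs_sub _ _).trans (by linarith)
  refine (norm_add_le _ _).trans ?_
  rw [norm_mul, Complex.norm_I, mul_one, Complex.norm_real, Complex.norm_real, Real.norm_eq_abs,
    Real.norm_eq_abs, abs_div, abs_div, abs_of_pos (by positivity : 0 < 2 * Real.sqrt (1 + ρ)),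
    abs_of_pos (by positivity : 0 < 2 * Real.sqrt (1 - ρ)), add_mul]
  gcongr
  · rw [div_le_iff₀ (by positivity)]
    field_simp
    linarith
  · rw [div_le_iff₀ (by positivity)]
    field_simp
    linarith

lemma giniKernel_smul (a b : Fin 2) {r : ℝ} (hr : 0 ≤ r) (w : EuclideanSpace ℝ (Fin 2)) :
    giniKernel a b (r • w) = r * giniKernel a b w := by
  rcases hr.eq_or_lt with rfl | hr
  · simp [giniKernel]
  · simp only [giniKernel, PiLp.smul_apply, smul_eq_mul, norm_smul, Real.norm_eq_abs, abs_of_pos hr]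
    field_simp

lemma norm_ellipCircle (hρ : |ρ| < 1) (θ : ℝ) :
    ‖ellipCircle ρ θ‖ = Real.sqrt 2 * Real.sqrt (1 + ρ * Real.cos (2 * θ)) := by
  have hp2 := Real.sq_sqrt (Real.sqrt_pos.mp (sqrt_one_add_pos hρ)).le
  have hq2 := Real.sq_sqrt (Real.sqrt_pos.mp (sqrt_one_sub_pos hρ)).le
  rw [EuclideanSpace.norm_eq, ← Real.sqrt_mul (by norm_num), Fin.sum_univ_two]
  congr 1
  simp only [ellipCircle, Real.norm_eq_abs, sq_abs, Matrix.cons_val_zero, Matrix.cons_val_one,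
    Matrix.cons_val_fin_one]
  rw [Real.cos_two_mul]
  have h := Real.sin_sq_add_cos_sq θ
  linear_combination 2 * Real.cos θ ^ 2 * hp2 + 2 * Real.sin θ ^ 2 * hq2 + 2 * (1 - ρ) * h

/-- Mean of the Gini kernel over the ellipse (up to the factor `1 / (2π)`). -/
noncomputable def ellipMean (a b : Fin 2) (ρ : ℝ) : ℝ :=
  ∫ θ in (0 : ℝ)..(2 * Real.pi), giniKernel a b (ellipCircle ρ θ)

/-- By homogeneity and periodicity the mean of the kernel over the orbit of `w` depends on `w` only
through the factor `ellipNorm ρ w`. -/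
lemma integral_giniKernel_ellipRot (hρ : |ρ| < 1) (a b : Fin 2) (w : EuclideanSpace ℝ (Fin 2)) :
    ∫ θ in (0 : ℝ)..(2 * Real.pi),
        giniKernel a b (Matrix.toEuclideanLin (ellipRot ρ θ) w)
      = ellipNorm ρ w * ellipMean a b ρ := by
  obtain ⟨α, hα⟩ := exists_eq_ellipNorm_smul hρ w
  have h1 : ∀ θ, giniKernel a b (Matrix.toEuclideanLin (ellipRot ρ θ) w)
      = ellipNorm ρ w * giniKernel a b (ellipCircle ρ (θ + α)) := by
    intro θ
    conv_lhs => rw [hα]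
    rw [ellipRot_smul_ellipCircle hρ, giniKernel_smul _ _ (ellipNorm_nonneg w)]
  have hper : Function.Periodic (fun θ => giniKernel a b (ellipCircle ρ θ)) (2 * Real.pi) := by
    intro θ
    simp [ellipCircle]
  simp_rw [h1]
  rw [intervalIntegral.integral_const_mul,
    intervalIntegral.integral_comp_add_right (fun θ => giniKernel a b (ellipCircle ρ θ)) α,
    zero_add, add_comm (2 * Real.pi) α, hper.intervalIntegral_add_eq α 0, zero_add, ellipMean]

lemma abs_giniKernel_ellipRot_le (hρ : |ρ| < 1) (a b : Fin 2) (θ : ℝ)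
    (w : EuclideanSpace ℝ (Fin 2)) :
    |giniKernel a b (Matrix.toEuclideanLin (ellipRot ρ θ) w)| ≤ 2 * ellipNorm ρ w := by
  obtain ⟨α, hα⟩ := exists_eq_ellipNorm_smul hρ w
  have h0 := ellipNorm_nonneg (ρ := ρ) w
  conv_lhs => rw [hα]
  rw [ellipRot_smul_ellipCircle hρ, giniKernel_smul _ _ h0, abs_mul, abs_of_nonneg h0, mul_comm]
  gcongr
  refine (abs_giniKernel_le a b _).trans ?_
  rw [norm_ellipCircle hρ, ← Real.sqrt_mul (by norm_num)]
  refine Real.sqrt_le_iff.mpr ⟨by norm_num, ?_⟩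
  have := abs_lt.mp hρ
  nlinarith [Real.neg_one_le_cos (2 * (θ + α)), Real.cos_le_one (2 * (θ + α))]

lemma integral_comp_cos_two_mul {g : ℝ → ℝ} (hg : Continuous fun φ => g (Real.cos φ)) :
    ∫ θ in (0 : ℝ)..(2 * Real.pi), g (Real.cos (2 * θ))
      = 2 * ∫ φ in (0 : ℝ)..Real.pi, g (Real.cos φ) := by
  have hper : Function.Periodic (fun φ => g (Real.cos φ)) (2 * Real.pi) := fun φ => by simp
  have hI : ∀ a b : ℝ, IntervalIntegrable (fun φ => g (Real.cos φ)) volume a b :=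
    fun a b => hg.intervalIntegrable a b
  have h1 : ∫ φ in (2 * Real.pi)..(2 * Real.pi + 2 * Real.pi), g (Real.cos φ)
      = ∫ φ in (0 : ℝ)..(0 + 2 * Real.pi), g (Real.cos φ) :=
    hper.intervalIntegral_add_eq _ _
  have h2 : ∫ φ in Real.pi..(2 * Real.pi), g (Real.cos φ)
      = ∫ φ in (0 : ℝ)..Real.pi, g (Real.cos φ) := by
    have h := intervalIntegral.integral_comp_sub_left (a := 0) (b := Real.pi)
      (fun φ => g (Real.cos φ)) (2 * Real.pi)
    simp only [Real.cos_two_pi_sub, sub_zero] at h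
    rw [h]
    congr 1
    ring
  rw [intervalIntegral.integral_comp_mul_left (fun φ => g (Real.cos φ)) two_ne_zero, mul_zero,
    show 2 * (2 * Real.pi) = 2 * Real.pi + 2 * Real.pi by ring,
    ← intervalIntegral.integral_add_adjacent_intervals (hI 0 (2 * Real.pi)) (hI _ _), h1, zero_add,
    ← intervalIntegral.integral_add_adjacent_intervals (hI 0 Real.pi) (hI _ _), h2, smul_eq_mul]
  ring

lemma ellipMean_zero_one (hρ : |ρ| < 1) : ellipMean 0 1 ρ = Real.sqrt 2 * linkNum ρ := by
  have hp2 := Real.sq_sqrt (Real.sqrt_pos.mp (sqrt_one_add_pos hρ)).le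
  have hq2 := Real.sq_sqrt (Real.sqrt_pos.mp (sqrt_one_sub_pos hρ)).le
  have h1 : ∀ θ, giniKernel 0 1 (ellipCircle ρ θ) = (Real.sqrt 2)⁻¹ *
      ((ρ + Real.cos (2 * θ)) / Real.sqrt (1 + ρ * Real.cos (2 * θ))) := by
    intro θ
    rw [giniKernel, norm_ellipCircle hρ, ← div_eq_inv_mul, div_div, mul_comm (Real.sqrt 2)]
    congr 1
    simp only [ellipCircle, Matrix.cons_val_zero, Matrix.cons_val_one, Matrix.cons_val_fin_one]
    rw [Real.cos_two_mul]
    have h := Real.sin_sq_add_cos_sq θ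
    linear_combination Real.cos θ ^ 2 * hp2 - Real.sin θ ^ 2 * hq2 + (ρ - 1) * h
  have hcont : Continuous fun φ => (ρ + Real.cos φ) / Real.sqrt (1 + ρ * Real.cos φ) :=
    Continuous.div (by fun_prop) (by fun_prop) (sqrt_one_add_mul_cos_ne hρ)
  rw [ellipMean]
  simp_rw [h1]
  rw [intervalIntegral.integral_const_mul,
    integral_comp_cos_two_mul (g := fun c => (ρ + c) / Real.sqrt (1 + ρ * c)) hcont, ← linkNum]
  have h2 := Real.sq_sqrt (zero_le_two (α := ℝ))
  field_simp
  rw [h2]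

lemma integral_sin_two_mul_div :
    ∫ θ in (0 : ℝ)..(2 * Real.pi), Real.sin (2 * θ) / Real.sqrt (1 + ρ * Real.cos (2 * θ)) = 0 := by
  set f : ℝ → ℝ := fun θ => Real.sin (2 * θ) / Real.sqrt (1 + ρ * Real.cos (2 * θ)) with hf
  have h := intervalIntegral.integral_comp_sub_left (a := 0) (b := 2 * Real.pi) f (2 * Real.pi)
  have hodd : ∀ θ, f (2 * Real.pi - θ) = -f θ := by
    intro θ
    have e : 2 * (2 * Real.pi - θ) = -(2 * θ) + 2 * Real.pi + 2 * Real.pi := by ring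
    simp only [hf, e, Real.sin_add_two_pi, Real.cos_add_two_pi, Real.sin_neg, Real.cos_neg, neg_div]
  simp only [hodd, intervalIntegral.integral_neg, sub_self, sub_zero] at h
  linarith

lemma ellipMean_diag (hρ : |ρ| < 1) {a : Fin 2} {c : ℝ}
    (h1 : ∀ θ, ellipCircle ρ θ a ^ 2 = 1 + ρ * Real.cos (2 * θ) + c * Real.sin (2 * θ)) :
    ellipMean a a ρ = Real.sqrt 2 * linkDen ρ := by
  have h2 : ∀ θ, giniKernel a a (ellipCircle ρ θ) = (Real.sqrt 2)⁻¹ *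
      (Real.sqrt (1 + ρ * Real.cos (2 * θ))
        + c * (Real.sin (2 * θ) / Real.sqrt (1 + ρ * Real.cos (2 * θ)))) := by
    intro θ
    have hs := sqrt_one_add_mul_cos_ne hρ (2 * θ)
    have hs2 := Real.sq_sqrt (one_add_mul_cos_pos hρ (2 * θ)).le
    rw [giniKernel, ← sq, h1, norm_ellipCircle hρ]
    field_simp
    rw [hs2]
  have hcont : Continuous fun θ => Real.sin (2 * θ) / Real.sqrt (1 + ρ * Real.cos (2 * θ)) :=
    Continuous.div (by fun_prop) (by fun_prop) fun θ => sqrt_one_add_mul_cos_ne hρ (2 * θ)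
  rw [ellipMean]
  simp_rw [h2]
  rw [intervalIntegral.integral_const_mul, intervalIntegral.integral_add
      (Continuous.intervalIntegrable (by fun_prop) _ _)
      ((hcont.const_mul c).intervalIntegrable _ _), intervalIntegral.integral_const_mul,
    integral_sin_two_mul_div,
    integral_comp_cos_two_mul (g := fun x => Real.sqrt (1 + ρ * x)) (by fun_prop), ← linkDen]
  have h2 := Real.sq_sqrt (zero_le_two (α := ℝ))
  field_simp
  rw [h2]
  ring

lemma ellipMean_zero_zero (hρ : |ρ| < 1) : ellipMean 0 0 ρ = Real.sqrt 2 * linkDen ρ := by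
  have hp2 := Real.sq_sqrt (Real.sqrt_pos.mp (sqrt_one_add_pos hρ)).le
  have hq2 := Real.sq_sqrt (Real.sqrt_pos.mp (sqrt_one_sub_pos hρ)).le
  refine ellipMean_diag hρ (c := -(Real.sqrt (1 + ρ) * Real.sqrt (1 - ρ))) fun θ => ?_
  simp only [ellipCircle, Matrix.cons_val_zero]
  rw [Real.cos_two_mul, Real.sin_two_mul]
  have h := Real.sin_sq_add_cos_sq θ
  linear_combination Real.cos θ ^ 2 * hp2 + Real.sin θ ^ 2 * hq2 + (1 - ρ) * h

lemma ellipMean_one_one (hρ : |ρ| < 1) : ellipMean 1 1 ρ = Real.sqrt 2 * linkDen ρ := by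
  have hp2 := Real.sq_sqrt (Real.sqrt_pos.mp (sqrt_one_add_pos hρ)).le
  have hq2 := Real.sq_sqrt (Real.sqrt_pos.mp (sqrt_one_sub_pos hρ)).le
  refine ellipMean_diag hρ (c := Real.sqrt (1 + ρ) * Real.sqrt (1 - ρ)) fun θ => ?_
  simp only [ellipCircle, Matrix.cons_val_one, Matrix.cons_val_fin_one]
  rw [Real.cos_two_mul, Real.sin_two_mul]
  have h := Real.sin_sq_add_cos_sq θ
  linear_combination Real.cos θ ^ 2 * hp2 + Real.sin θ ^ 2 * hq2 + (1 - ρ) * h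

end Ellipse

/-! ### The Gini correlation of an elliptical law -/

section Elliptical

variable {ρ σ : ℝ}

lemma abs_lt_one_of_posDef (h : (σ ^ 2 • !![1, ρ; ρ, 1] : Matrix (Fin 2) (Fin 2) ℝ).PosDef) :
    0 < σ ^ 2 ∧ |ρ| < 1 := by
  have h1 := h.diag_pos (i := 0)
  have h2 := h.det_pos
  simp only [Matrix.smul_apply, Matrix.of_apply, Matrix.cons_val', Matrix.cons_val_zero,
    Matrix.cons_val_fin_one, smul_eq_mul, mul_one] at h1
  rw [Matrix.det_smul, Matrix.det_fin_two_of] at h2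
  simp only [Fintype.card_fin, mul_one] at h2
  refine ⟨h1, ?_⟩
  have h3 := pos_of_mul_pos_right h2 (by positivity)
  rw [← sq_lt_one_iff_abs_lt_one]
  linarith

lemma scatter_inv (hσ : 0 < σ ^ 2) (hρ : |ρ| < 1) :
    (σ ^ 2 • !![1, ρ; ρ, 1] : Matrix (Fin 2) (Fin 2) ℝ)⁻¹
      = (σ ^ 2 * (1 - ρ ^ 2))⁻¹ • !![1, -ρ; -ρ, 1] := by
  have h : 1 - ρ ^ 2 ≠ 0 := by
    have := (sq_lt_one_iff_abs_lt_one ρ).mpr hρ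
    linarith
  have hσ' : σ ≠ 0 := by rintro rfl; simp at hσ
  refine Matrix.inv_eq_right_inv ?_
  rw [Matrix.smul_mul, Matrix.mul_smul, smul_smul]
  ext i j
  fin_cases i <;> fin_cases j <;> simp <;> field_simp
  all_goals ring

/-- The maps `ellipRot ρ θ` preserve the quadratic form of the inverse scatter matrix. -/
lemma quadForm_ellipRot (hσ : 0 < σ ^ 2) (hρ : |ρ| < 1) (θ : ℝ)
    (w : EuclideanSpace ℝ (Fin 2)) :
    (Matrix.toEuclideanLin (ellipRot ρ θ) w).ofLp ⬝ᵥ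
        ((σ ^ 2 • !![1, ρ; ρ, 1] : Matrix (Fin 2) (Fin 2) ℝ)⁻¹ *ᵥ
          (Matrix.toEuclideanLin (ellipRot ρ θ) w).ofLp)
      = w.ofLp ⬝ᵥ ((σ ^ 2 • !![1, ρ; ρ, 1] : Matrix (Fin 2) (Fin 2) ℝ)⁻¹ *ᵥ w.ofLp) := by
  have hQ : ∀ v : EuclideanSpace ℝ (Fin 2), v.ofLp ⬝ᵥ
      ((σ ^ 2 • !![1, ρ; ρ, 1] : Matrix (Fin 2) (Fin 2) ℝ)⁻¹ *ᵥ v.ofLp)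
      = (σ ^ 2 * (1 - ρ ^ 2))⁻¹ * (v 0 ^ 2 - 2 * ρ * v 0 * v 1 + v 1 ^ 2) := by
    intro v
    rw [scatter_inv hσ hρ]
    simp [Matrix.mulVec, dotProduct, Fin.sum_univ_two]
    ring
  have hs : 0 < Real.sqrt (1 - ρ ^ 2) := by
    rw [sqrt_one_sub_sq hρ]
    exact mul_pos (sqrt_one_add_pos hρ) (sqrt_one_sub_pos hρ)
  have hs2 := Real.sq_sqrt (Real.sqrt_pos.mp hs).le
  have h := Real.sin_sq_add_cos_sq θ
  rw [hQ, hQ]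
  congr 1
  rw [toEuclideanLin_apply_zero, toEuclideanLin_apply_one]
  simp only [ellipRot, Matrix.of_apply, Matrix.cons_val', Matrix.cons_val_zero,
    Matrix.cons_val_one, Matrix.cons_val_fin_one]
  generalize Real.sqrt (1 - ρ ^ 2) = s at *
  generalize w.ofLp 0 = x at *
  generalize w.ofLp 1 = y at *
  field_simp
  linear_combination (s ^ 2 * (x ^ 2 - 2 * ρ * x * y + y ^ 2)) * h
    - (Real.sin θ ^ 2 * (x ^ 2 - 2 * ρ * x * y + y ^ 2)) * hs2

lemma measurePreserving_ellipRot (hρ : |ρ| < 1) (θ : ℝ) :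
    MeasurePreserving (Matrix.toEuclideanLin (ellipRot ρ θ))
      (volume : Measure (EuclideanSpace ℝ (Fin 2))) volume := by
  refine ⟨(LinearMap.continuous_of_finiteDimensional _).measurable, ?_⟩
  have hdet : LinearMap.det (Matrix.toEuclideanLin (ellipRot ρ θ)) = 1 := by
    rw [Matrix.toEuclideanLin_eq_toLin_orthonormal, LinearMap.det_toLin, det_ellipRot hρ]
  rw [Measure.map_linearMap_addHaar_eq_smul_addHaar _ (by rw [hdet]; exact one_ne_zero), hdet]
  simp

/-- A measure-preserving map that leaves a density invariant preserves the measure with that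
density. -/
lemma MeasureTheory.MeasurePreserving.withDensity_of_comp_eq {α : Type*} [MeasurableSpace α]
    {μ : Measure α} {T : α → α} (hT : MeasurePreserving T μ μ) {f : α → ℝ≥0∞} (hf : Measurable f)
    (hfT : ∀ x, f (T x) = f x) : MeasurePreserving T (μ.withDensity f) (μ.withDensity f) := by
  refine ⟨hT.measurable, ?_⟩
  ext s hs
  rw [Measure.map_apply hT.measurable hs, withDensity_apply _ (hT.measurable hs),
    withDensity_apply _ hs, ← hT.setLIntegral_comp_preimage hs hf]
  simp_rw [hfT]

variable {H : Measure (EuclideanSpace ℝ (Fin 2))} {m : EuclideanSpace ℝ (Fin 2)}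

lemma IsElliptical.measurePreserving (hH : IsElliptical H m (σ ^ 2 • !![1, ρ; ρ, 1])) (θ : ℝ) :
    MeasurePreserving (fun z => m + Matrix.toEuclideanLin (ellipRot ρ θ) (z - m)) H H := by
  obtain ⟨hpd, g, hg, rfl⟩ := hH
  obtain ⟨hσ, hρ⟩ := abs_lt_one_of_posDef hpd
  have hT : MeasurePreserving (fun z => m + Matrix.toEuclideanLin (ellipRot ρ θ) (z - m))
      (volume : Measure (EuclideanSpace ℝ (Fin 2))) volume :=
    (measurePreserving_add_left volume m).comp
      ((measurePreserving_ellipRot hρ θ).comp (measurePreserving_sub_right volume m))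
  refine hT.withDensity_of_comp_eq ?_ fun z => ?_
  · have hQ : Continuous fun z : EuclideanSpace ℝ (Fin 2) => (z - m).ofLp ⬝ᵥ
        ((σ ^ 2 • !![1, ρ; ρ, 1] : Matrix (Fin 2) (Fin 2) ℝ)⁻¹ *ᵥ (z - m).ofLp) := by
      simp only [Matrix.mulVec, dotProduct]
      fun_prop
    exact (((hg.comp hQ.measurable).coe_nnreal_real).const_mul _).ennreal_ofReal
  · rw [add_sub_cancel_left, quadForm_ellipRot hσ hρ]

/-- The mean of `ellipNorm ρ` at the difference of two independent observations. -/
noncomputable def ellipScale (ρ : ℝ) (H : Measure (EuclideanSpace ℝ (Fin 2))) : ℝ :=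
  ∫ p, ellipNorm ρ (p.1 - p.2) ∂(H.prod H)

variable [IsProbabilityMeasure H]

lemma integrable_ellipNorm (hρ : |ρ| < 1) (hint : Integrable (fun z => ‖z‖) H) :
    Integrable (fun p : EuclideanSpace ℝ (Fin 2) × EuclideanSpace ℝ (Fin 2) =>
      ellipNorm ρ (p.1 - p.2)) (H.prod H) := by
  refine Integrable.mono' (((hint.comp_fst H).add (hint.comp_snd H)).const_mul
    ((Real.sqrt (1 + ρ))⁻¹ + (Real.sqrt (1 - ρ))⁻¹)) ?_ (ae_of_all _ fun p => ?_)
  · exact Continuous.aestronglyMeasurable (by fun_prop)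
  · rw [Real.norm_eq_abs, abs_of_nonneg (ellipNorm_nonneg _)]
    refine (ellipNorm_le hρ _).trans ?_
    have := norm_sub_le p.1 p.2
    simp only [Pi.add_apply]
    gcongr

lemma measurable_giniKernel_ellipRot (a b : Fin 2) :
    Measurable fun q : ℝ × (EuclideanSpace ℝ (Fin 2) × EuclideanSpace ℝ (Fin 2)) =>
      giniKernel a b (Matrix.toEuclideanLin (ellipRot ρ q.1) (q.2.1 - q.2.2)) := by
  refine (measurable_giniKernel a b).comp ?_
  have hm : ∀ i j, Measurable fun θ => ellipRot ρ θ i j := by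
    intro i j
    fin_cases i <;> fin_cases j <;> simp [ellipRot] <;> fun_prop
  refine (WithLp.measurable_toLp 2 _).comp (measurable_pi_iff.mpr fun i => ?_)
  have hrow : Measurable fun q : ℝ × (EuclideanSpace ℝ (Fin 2) × EuclideanSpace ℝ (Fin 2)) =>
      ellipRot ρ q.1 i 0 * (q.2.1 - q.2.2) 0 + ellipRot ρ q.1 i 1 * (q.2.1 - q.2.2) 1 :=
    (((hm i 0).comp measurable_fst).mul (by fun_prop)).add
      (((hm i 1).comp measurable_fst).mul (by fun_prop))
  convert hrow using 2 with q
  fin_cases i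
  · exact toEuclideanLin_apply_zero _ _
  · exact toEuclideanLin_apply_one _ _

/-- Averaging the kernel over the group of elliptical rotations. -/
lemma IsElliptical.giniCov_mul_two_pi (hH : IsElliptical H m (σ ^ 2 • !![1, ρ; ρ, 1]))
    (hint : Integrable (fun z => ‖z‖) H) (a b : Fin 2) :
    2 * Real.pi * giniCov a b H = ellipScale ρ H * ellipMean a b ρ := by
  obtain ⟨hσ, hρ⟩ := abs_lt_one_of_posDef hH.1
  have hrot : ∀ θ, giniCov a b H = ∫ p, giniKernel a b
      (Matrix.toEuclideanLin (ellipRot ρ θ) (p.1 - p.2)) ∂(H.prod H) := by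
    intro θ
    have hmp := (hH.measurePreserving θ).prod (hH.measurePreserving θ)
    rw [giniCov_eq hint]
    unfold giniProj
    rw [← integral_prod _ (integrable_giniKernel_prod hint a b)]
    conv_lhs => rw [← hmp.map_eq]
    rw [integral_map hmp.measurable.aemeasurable
      (by fun_prop : Measurable fun p : EuclideanSpace ℝ (Fin 2) × EuclideanSpace ℝ (Fin 2) =>
        giniKernel a b (p.1 - p.2)).aestronglyMeasurable]
    simp only [Prod.map_fst, Prod.map_snd, add_sub_add_left_eq_sub, ← map_sub,
      sub_sub_sub_cancel_right]
  have : IsFiniteMeasure ((volume : Measure ℝ).restrict (Set.uIoc 0 (2 * Real.pi))) :=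
    ⟨by simp [Set.uIoc, ENNReal.ofReal_lt_top]⟩
  have hi : Integrable (Function.uncurry fun (θ : ℝ)
      (p : EuclideanSpace ℝ (Fin 2) × EuclideanSpace ℝ (Fin 2)) =>
        giniKernel a b (Matrix.toEuclideanLin (ellipRot ρ θ) (p.1 - p.2)))
      ((volume.restrict (Set.uIoc 0 (2 * Real.pi))).prod (H.prod H)) := by
    refine Integrable.mono' (((integrable_ellipNorm hρ hint).const_mul 2).comp_snd _)
      (measurable_giniKernel_ellipRot a b).aestronglyMeasurable (ae_of_all _ fun q => ?_)
    exact abs_giniKernel_ellipRot_le hρ a b q.1 _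
  calc 2 * Real.pi * giniCov a b H
      = ∫ _ in (0 : ℝ)..(2 * Real.pi), giniCov a b H := by simp
    _ = ∫ θ in (0 : ℝ)..(2 * Real.pi), ∫ p, giniKernel a b
          (Matrix.toEuclideanLin (ellipRot ρ θ) (p.1 - p.2)) ∂(H.prod H) :=
        intervalIntegral.integral_congr fun θ _ => hrot θ
    _ = ∫ p, (∫ θ in (0 : ℝ)..(2 * Real.pi), giniKernel a b
          (Matrix.toEuclideanLin (ellipRot ρ θ) (p.1 - p.2))) ∂(H.prod H) :=
        intervalIntegral_integral_swap hi
    _ = ellipScale ρ H * ellipMean a b ρ := by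
        simp_rw [integral_giniKernel_ellipRot hρ]
        rw [integral_mul_const, ellipScale]

lemma IsElliptical.ellipScale_pos (hH : IsElliptical H m (σ ^ 2 • !![1, ρ; ρ, 1]))
    (hint : Integrable (fun z => ‖z‖) H) : 0 < ellipScale ρ H := by
  obtain ⟨hσ, hρ⟩ := abs_lt_one_of_posDef hH.1
  have hnn : 0 ≤ fun p : EuclideanSpace ℝ (Fin 2) × EuclideanSpace ℝ (Fin 2) =>
      ellipNorm ρ (p.1 - p.2) := fun p => ellipNorm_nonneg _
  refine lt_of_le_of_ne (integral_nonneg hnn) fun h0 => ?_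
  have h1 := (integral_eq_zero_iff_of_nonneg hnn (integrable_ellipNorm hρ hint)).mp h0.symm
  obtain ⟨z, hz⟩ := (Measure.ae_ae_of_ae_prod h1).exists
  have h2 : ∀ᵐ w ∂H, w = z := by
    filter_upwards [hz] with w hw
    exact (sub_eq_zero.mp (eq_zero_of_ellipNorm_eq_zero hρ hw)).symm
  -- A law with a density has no atoms.
  have h3 : H ≪ volume := by
    obtain ⟨-, g, -, rfl⟩ := hH
    exact withDensity_absolutelyContinuous _ _
  have h4 : ∀ᵐ w ∂H, w ≠ z := h3.ae_le (compl_mem_ae_iff.mpr (measure_singleton z))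
  obtain ⟨w, hw1, hw2⟩ := (h2.and h4).exists
  exact hw2 hw1

/-- The Gini covariances of an elliptical law, up to a common positive factor. -/
lemma IsElliptical.giniCov_eq (hH : IsElliptical H m (σ ^ 2 • !![1, ρ; ρ, 1]))
    (hint : Integrable (fun z => ‖z‖) H) :
    ∃ c : ℝ, 0 < c ∧ giniCov 0 0 H = c * linkDen ρ ∧ giniCov 1 1 H = c * linkDen ρ ∧
      giniCov 0 1 H = c * linkNum ρ := by
  obtain ⟨hσ, hρ⟩ := abs_lt_one_of_posDef hH.1
  have hπ := Real.pi_pos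
  have hc := hH.ellipScale_pos hint
  refine ⟨ellipScale ρ H * Real.sqrt 2 / (2 * Real.pi), by positivity, ?_, ?_, ?_⟩
  · have h := hH.giniCov_mul_two_pi hint 0 0
    rw [ellipMean_zero_zero hρ] at h
    field_simp
    linarith
  · have h := hH.giniCov_mul_two_pi hint 1 1
    rw [ellipMean_one_one hρ] at h
    field_simp
    linarith
  · have h := hH.giniCov_mul_two_pi hint 0 1
    rw [ellipMean_zero_one hρ] at h
    field_simp
    linarith

lemma IsElliptical.giniCov_pos (hH : IsElliptical H m (σ ^ 2 • !![1, ρ; ρ, 1]))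
    (hint : Integrable (fun z => ‖z‖) H) : 0 < giniCov 0 0 H ∧ 0 < giniCov 1 1 H := by
  obtain ⟨hσ, hρ⟩ := abs_lt_one_of_posDef hH.1
  obtain ⟨c, hc, h0, h1, -⟩ := hH.giniCov_eq hint
  have hD := linkDen_pos (mem_Icc_of_abs_lt_one hρ)
  exact ⟨h0 ▸ mul_pos hc hD, h1 ▸ mul_pos hc hD⟩

lemma IsElliptical.giniCorr_eq (hH : IsElliptical H m (σ ^ 2 • !![1, ρ; ρ, 1]))
    (hint : Integrable (fun z => ‖z‖) H) : giniCorr H = giniLink ρ := by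
  obtain ⟨hσ, hρ⟩ := abs_lt_one_of_posDef hH.1
  obtain ⟨c, hc, h0, h1, h2⟩ := hH.giniCov_eq hint
  have hD := linkDen_pos (mem_Icc_of_abs_lt_one hρ)
  rw [giniCorr, h0, h1, h2, Real.mul_self_sqrt (by positivity),
    giniLink_eq (mem_Icc_of_abs_lt_one hρ), mul_div_mul_left _ _ hc.ne']

lemma IsElliptical.giniCov_ne_zero (hH : IsElliptical H m (σ ^ 2 • !![1, ρ; ρ, 1]))
    (hint : Integrable (fun z => ‖z‖) H) (h : ρ ≠ 0) : giniCov 0 1 H ≠ 0 := by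
  obtain ⟨hσ, hρ⟩ := abs_lt_one_of_posDef hH.1
  intro h0
  have h1 : giniLink ρ = giniLink 0 := by
    rw [← hH.giniCorr_eq hint, giniCorr, h0, zero_div, giniLink_zero]
  exact h (strictMonoOn_giniLink.injOn (mem_Icc_of_abs_lt_one hρ) (by simp) h1)

end Elliptical

/-! ### Second moments and convergence in probability -/

section SecondMoment

variable {Ω : Type*} [MeasurableSpace Ω] {P : Measure Ω}

/-- Chebyshev's inequality, without centering. -/
lemma measure_ge_le_of_integral_sq {f : Ω → ℝ} [IsFiniteMeasure P] (hf : MemLp f 2 P) {δ : ℝ}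
    (hδ : 0 < δ) : P {ω | δ ≤ |f ω|} ≤ ENNReal.ofReal ((∫ ω, f ω ^ 2 ∂P) / δ ^ 2) := by
  have h := mul_meas_ge_le_integral_of_nonneg (μ := P) (f := fun ω => f ω ^ 2)
    (ae_of_all _ fun ω => sq_nonneg _) hf.integrable_sq (δ ^ 2)
  have hset : {ω | δ ^ 2 ≤ f ω ^ 2} = {ω | δ ≤ |f ω|} := by
    ext ω
    simp only [Set.mem_ofPred_eq]
    rw [← sq_abs (f ω), pow_le_pow_iff_left₀ hδ.le (abs_nonneg _) two_ne_zero]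
  rw [hset] at h
  rw [← ofReal_measureReal]
  apply ENNReal.ofReal_le_ofReal
  rw [le_div_iff₀ (by positivity)]
  linarith

lemma tendstoInMeasure_zero_of_integral_sq [IsFiniteMeasure P] {f : ℕ → Ω → ℝ}
    (hf : ∀ n, MemLp (f n) 2 P) (h : Tendsto (fun n => ∫ ω, f n ω ^ 2 ∂P) atTop (𝓝 0)) :
    TendstoInMeasure P f atTop 0 := by
  rw [tendstoInMeasure_iff_norm]
  intro ε hε
  have h1 : Tendsto (fun n => ENNReal.ofReal ((∫ ω, f n ω ^ 2 ∂P) / ε ^ 2)) atTop (𝓝 0) := by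
    simpa using ENNReal.tendsto_ofReal (h.div_const (ε ^ 2))
  refine tendsto_of_tendsto_of_tendsto_of_le_of_le tendsto_const_nhds h1 (fun _ => zero_le)
    fun n => ?_
  simpa using measure_ge_le_of_integral_sq (hf n) hε

/-- Convergence to `0` in measure is stable under addition. -/
lemma MeasureTheory.TendstoInMeasure.add_zero_real {f g : ℕ → Ω → ℝ}
    (hf : TendstoInMeasure P f atTop 0)
    (hg : TendstoInMeasure P g atTop 0) :
    TendstoInMeasure P (fun n ω => f n ω + g n ω) atTop 0 := by
  rw [tendstoInMeasure_iff_norm] at *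
  intro ε hε
  have h := (hf (ε / 2) (by positivity)).add (hg (ε / 2) (by positivity))
  rw [add_zero] at h
  refine tendsto_of_tendsto_of_tendsto_of_le_of_le tendsto_const_nhds h (fun _ => zero_le)
    fun n => ?_
  refine (measure_mono fun ω hω => ?_).trans (measure_union_le _ _)
  simp only [Pi.zero_apply, sub_zero, Real.norm_eq_abs, Set.mem_ofPred_eq, Set.mem_union] at *
  by_contra! hc
  linarith [abs_add_le (f n ω) (g n ω)]

/-- Pairwise orthogonal functions: the second moment of the sum is the sum of second moments. -/
lemma integral_sq_sum_of_orthogonal {ι : Type*} (s : Finset ι) {f : ι → Ω → ℝ}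
    (hf : ∀ a ∈ s, MemLp (f a) 2 P)
    (horth : ∀ a ∈ s, ∀ b ∈ s, a ≠ b → ∫ ω, f a ω * f b ω ∂P = 0) :
    ∫ ω, (∑ a ∈ s, f a ω) ^ 2 ∂P = ∑ a ∈ s, ∫ ω, f a ω ^ 2 ∂P := by
  have hi : ∀ a ∈ s, ∀ b ∈ s, Integrable (fun ω => f a ω * f b ω) P :=
    fun a ha b hb => (hf a ha).integrable_mul (hf b hb)
  simp_rw [sq, Finset.sum_mul_sum]
  rw [integral_finsetSum _ fun a ha => integrable_finsetSum _ fun b hb => hi a ha b hb]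
  refine Finset.sum_congr rfl fun a ha => ?_
  rw [integral_finsetSum _ fun b hb => hi a ha b hb]
  exact Finset.sum_eq_single_of_mem a ha fun b hb hba => horth a ha b hb hba.symm

end SecondMoment

/-! ### Degenerate U-statistics -/

section UStatistic

variable {Ω : Type*} [MeasurableSpace Ω] {P : Measure Ω} [IsProbabilityMeasure P]
  {α : Type*} [MeasurableSpace α] {H : Measure α}
  {Z : ℕ → Ω → α} {h : α × α → ℝ}

lemma hasLaw_pair (hlaw : ∀ i, HasLaw (Z i) H P) (hindep : iIndepFun Z P) {i j : ℕ} (hij : i ≠ j) :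
    HasLaw (fun ω => (Z i ω, Z j ω)) (H.prod H) P :=
  (hindep.indepFun hij).hasLaw_prod (hlaw i) (hlaw j)

lemma memLp_pair (hlaw : ∀ i, HasLaw (Z i) H P) (hindep : iIndepFun Z P)
    (h2 : MemLp h 2 (H.prod H)) {i j : ℕ} (hij : i ≠ j) :
    MemLp (fun ω => h (Z i ω, Z j ω)) 2 P := by
  have hl := hasLaw_pair hlaw hindep hij
  rw [← hl.map_eq] at h2
  exact h2.comp_of_map hl.aemeasurable

variable [IsProbabilityMeasure H]

/-- A degenerate kernel is conditionally centred given all observations but one. -/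
lemma integral_mul_eq_zero_of_degenerate (hlaw : ∀ i, HasLaw (Z i) H P) (hindep : iIndepFun Z P)
    (hm : Measurable h) (hdeg : ∀ x, ∫ y, h (x, y) ∂H = 0) {p q k l : ℕ}
    (hpq : p ≠ q) (hpk : p ≠ k) (hpl : p ≠ l) :
    ∫ ω, h (Z q ω, Z p ω) * h (Z k ω, Z l ω) ∂P = 0 := by
  have hdisj : Disjoint ({q, k, l} : Finset ℕ) {p} := by
    simp [hpq, hpk, hpl]
  have hX : AEMeasurable (fun ω => (Z q ω, (Z k ω, Z l ω))) P :=
    (hlaw q).aemeasurable.prodMk ((hlaw k).aemeasurable.prodMk (hlaw l).aemeasurable)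
  have hi : IndepFun (fun ω => (Z q ω, (Z k ω, Z l ω))) (Z p) P := by
    refine (hindep.indepFun_finset₀ {q, k, l} {p} hdisj fun i => (hlaw i).aemeasurable).comp
      (φ := fun u => (u ⟨q, by simp⟩, (u ⟨k, by simp⟩, u ⟨l, by simp⟩)))
      (ψ := fun u => u ⟨p, by simp⟩) ?_ ?_ <;> fun_prop
  have hmap := (indepFun_iff_map_prod_eq_prod_map_map hX (hlaw p).aemeasurable).mp hi
  rw [(hlaw p).map_eq] at hmap
  set F : (α × (α × α)) × α → ℝ := fun u => h (u.1.1, u.2) * h u.1.2 with hF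
  have hFm : Measurable F := by fun_prop
  have : IsProbabilityMeasure (P.map fun ω => (Z q ω, (Z k ω, Z l ω))) :=
    Measure.isProbabilityMeasure_map hX
  have h1 : ∫ ω, h (Z q ω, Z p ω) * h (Z k ω, Z l ω) ∂P
      = ∫ u, F u ∂((P.map fun ω => (Z q ω, (Z k ω, Z l ω))).prod H) := by
    rw [← hmap, integral_map (hX.prodMk (hlaw p).aemeasurable) hFm.aestronglyMeasurable]
  rw [h1]
  by_cases hint : Integrable F ((P.map fun ω => (Z q ω, (Z k ω, Z l ω))).prod H)
  · rw [integral_prod _ hint]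
    simp [hF, integral_mul_const, hdeg]
  · exact integral_undef hint

/-- The pairs `i < j < n`, encoded as `⟨j, i⟩`. -/
def ltPairs (n : ℕ) : Finset (Σ _ : ℕ, ℕ) := (Finset.range n).sigma Finset.range

lemma card_ltPairs (n : ℕ) : ((ltPairs n).card : ℝ) = n * (n - 1) / 2 := by
  rw [ltPairs, Finset.card_sigma]
  simp only [Finset.card_range, Nat.cast_sum]
  induction n with
  | zero => simp
  | succ n ih => rw [Finset.sum_range_succ, ih]; push_cast; ring

/-- The second moment of the sum of a degenerate kernel over all pairs: distinct pairs are
uncorrelated. -/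
lemma integral_sq_sum_degenerate (hlaw : ∀ i, HasLaw (Z i) H P) (hindep : iIndepFun Z P)
    (hm : Measurable h) (hsymm : ∀ x y, h (x, y) = h (y, x))
    (hdeg : ∀ x, ∫ y, h (x, y) ∂H = 0) (h2 : MemLp h 2 (H.prod H)) (n : ℕ) :
    ∫ ω, (∑ j ∈ Finset.range n, ∑ i ∈ Finset.range j, h (Z i ω, Z j ω)) ^ 2 ∂P
      = n * (n - 1) / 2 * ∫ p, h p ^ 2 ∂(H.prod H) := by
  have hlt : ∀ a ∈ ltPairs n, a.2 < a.1 := fun a ha => by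
    simpa using (Finset.mem_sigma.mp ha).2
  have hsum : ∀ ω, ∑ j ∈ Finset.range n, ∑ i ∈ Finset.range j, h (Z i ω, Z j ω)
      = ∑ a ∈ ltPairs n, h (Z a.2 ω, Z a.1 ω) := fun ω =>
    (Finset.sum_sigma (Finset.range n) Finset.range fun a => h (Z a.2 ω, Z a.1 ω)).symm
  simp_rw [hsum]
  rw [integral_sq_sum_of_orthogonal (ltPairs n) (f := fun a ω => h (Z a.2 ω, Z a.1 ω))
    (fun a ha => memLp_pair hlaw hindep h2 (hlt a ha).ne)]
  · rw [← card_ltPairs, ← nsmul_eq_mul]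
    refine Finset.sum_eq_card_nsmul fun a ha => ?_
    exact (hasLaw_pair hlaw hindep (hlt a ha).ne).integral_comp
      (f := fun p => h p ^ 2) (hm.pow_const 2).aestronglyMeasurable
  · rintro ⟨j, i⟩ ha ⟨l, k⟩ hb hab
    have hij := hlt _ ha
    have hkl := hlt _ hb
    simp only at hij hkl ⊢
    by_cases hi : i ≠ k ∧ i ≠ l
    · simp_rw [hsymm (Z i _) (Z j _)]
      exact integral_mul_eq_zero_of_degenerate hlaw hindep hm hdeg hij.ne hi.1 hi.2
    · refine integral_mul_eq_zero_of_degenerate hlaw hindep hm hdeg hij.ne' ?_ ?_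
      · omega
      · rintro rfl
        have : i = k := by omega
        subst this
        exact hab rfl

lemma integral_sq_sum_iid {ψ : α → ℝ} (hlaw : ∀ i, HasLaw (Z i) H P) (hindep : iIndepFun Z P)
    (hψm : Measurable ψ) (hψ : MemLp ψ 2 H) (h0 : ∫ x, ψ x ∂H = 0) (n : ℕ) :
    ∫ ω, (∑ i ∈ Finset.range n, ψ (Z i ω)) ^ 2 ∂P = n * ∫ x, ψ x ^ 2 ∂H := by
  have hmem : ∀ i, MemLp (fun ω => ψ (Z i ω)) 2 P := fun i => by
    rw [← (hlaw i).map_eq] at hψ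
    exact hψ.comp_of_map (hlaw i).aemeasurable
  rw [integral_sq_sum_of_orthogonal (Finset.range n) (f := fun i ω => ψ (Z i ω))
    fun i _ => hmem i]
  · have h1 : ∀ i, ∫ ω, ψ (Z i ω) ^ 2 ∂P = ∫ x, ψ x ^ 2 ∂H := fun i =>
      (hlaw i).integral_comp (f := fun x => ψ x ^ 2) (hψm.pow_const 2).aestronglyMeasurable
    simp [h1]
  · intro i _ j _ hij
    have h1 : ∫ ω, ψ (Z i ω) * ψ (Z j ω) ∂P = ∫ p, ψ p.1 * ψ p.2 ∂(H.prod H) :=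
      (hasLaw_pair hlaw hindep hij).integral_comp (f := fun p : α × α => ψ p.1 * ψ p.2)
        (by fun_prop : Measurable fun p : α × α => ψ p.1 * ψ p.2).aestronglyMeasurable
    rw [h1, integral_prod_mul, h0, zero_mul]

end UStatistic

/-! ### The delta method -/

section DeltaMethod

variable {Ω : Type*} [MeasurableSpace Ω] {P : Measure Ω}
  {E : Type*} [NormedAddCommGroup E]

/-- `X n` satisfies a Chebyshev bound around `t` at the rate `√n`, with a constant that does not
depend on `n`. The indices `n < 2`, where a U-statistic of order two is not defined, are left out. -/
def HasChebyshevRate (P : Measure Ω) (X : ℕ → Ω → E) (t : E) : Prop :=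
  ∃ C : ℝ, 0 ≤ C ∧ ∀ n : ℕ, 2 ≤ n → ∀ δ : ℝ, 0 < δ →
    P {ω | δ ≤ ‖X n ω - t‖} ≤ ENNReal.ofReal (C / (n * δ ^ 2))

lemma HasChebyshevRate.tendsto {X : ℕ → Ω → E} {t : E} (hX : HasChebyshevRate P X t) {δ : ℝ}
    (hδ : 0 < δ) : Tendsto (fun n => P {ω | δ ≤ ‖X n ω - t‖}) atTop (𝓝 0) := by
  obtain ⟨C, -, hC⟩ := hX
  have h1 : Tendsto (fun n : ℕ => ENNReal.ofReal (C / (n * δ ^ 2))) atTop (𝓝 0) := by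
    have h : Tendsto (fun n : ℕ => C / (n * δ ^ 2)) atTop (𝓝 0) :=
      tendsto_const_nhds.div_atTop
        (tendsto_natCast_atTop_atTop.atTop_mul_const (by positivity))
    simpa using ENNReal.tendsto_ofReal h
  refine tendsto_of_tendsto_of_tendsto_of_le_of_le' tendsto_const_nhds h1
    (Eventually.of_forall fun _ => zero_le) ?_
  filter_upwards [eventually_ge_atTop 2] with n hn using hC n hn δ hδ

/-- The Chebyshev bound at the scale `√n`: the errors `√n ‖X n - t‖` are tight. -/
lemma HasChebyshevRate.sqrt_mul_le {X : ℕ → Ω → E} {t : E} {C : ℝ}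
    (hC : ∀ n : ℕ, 2 ≤ n → ∀ δ : ℝ, 0 < δ →
      P {ω | δ ≤ ‖X n ω - t‖} ≤ ENNReal.ofReal (C / (n * δ ^ 2))) {n : ℕ} (hn : 2 ≤ n) {M : ℝ}
    (hM : 0 < M) : P {ω | M ≤ Real.sqrt n * ‖X n ω - t‖} ≤ ENNReal.ofReal (C / M ^ 2) := by
  have hn0 : (0 : ℝ) < n := by exact_mod_cast (by omega : 0 < n)
  have hs := Real.sqrt_pos.mpr hn0
  have h := hC n hn (M / Real.sqrt n) (by positivity)
  rw [div_pow, Real.sq_sqrt hn0.le, mul_div_cancel₀ _ hn0.ne'] at h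
  refine (measure_mono fun ω hω => ?_).trans h
  simp only [Set.mem_ofPred_eq] at *
  rw [div_le_iff₀ hs, mul_comm]
  exact hω

lemma HasChebyshevRate.prodMk {F : Type*} [NormedAddCommGroup F]
    {X : ℕ → Ω → E} {Y : ℕ → Ω → F} {s : E} {t : F} (hX : HasChebyshevRate P X s)
    (hY : HasChebyshevRate P Y t) : HasChebyshevRate P (fun n ω => (X n ω, Y n ω)) (s, t) := by
  obtain ⟨C, hC, h1⟩ := hX
  obtain ⟨D, hD, h2⟩ := hY
  refine ⟨C + D, by positivity, fun n hn δ hδ => ?_⟩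
  rw [add_div, ENNReal.ofReal_add (by positivity) (by positivity)]
  refine le_trans (measure_mono fun ω hω => ?_)
    ((measure_union_le _ _).trans (add_le_add (h1 n hn δ hδ) (h2 n hn δ hδ)))
  simpa [Prod.norm_def] using hω

variable [NormedSpace ℝ E]

/-- A function that is differentiable at `t` maps `√n`-consistent estimators of `t` to
`√n`-consistent estimators. -/
lemma HasChebyshevRate.isRootNConsistent {X : ℕ → Ω → E} {t : E} (hX : HasChebyshevRate P X t)
    {f : E → ℝ} {f' : E →L[ℝ] ℝ} (hf : HasFDerivAt f f' t) {Y : ℕ → Ω → ℝ}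
    (hY : ∀ n, 2 ≤ n → ∀ ω, Y n ω = f (X n ω)) : IsRootNConsistent P Y (f t) := by
  intro ε hε
  obtain ⟨K, hK, hKb⟩ := hf.isBigO_sub.exists_pos
  rw [Asymptotics.isBigOWith_iff, Metric.eventually_nhds_iff] at hKb
  obtain ⟨δ, hδ, hb⟩ := hKb
  have ht := hX.tendsto hδ
  obtain ⟨C, hC0, hC⟩ := hX
  have hM : Tendsto (fun M : ℝ => C * K ^ 2 / M ^ 2) atTop (𝓝 0) :=
    tendsto_const_nhds.div_atTop (tendsto_pow_atTop two_ne_zero)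
  obtain ⟨M, hMε, hM0⟩ :=
    ((hM.eventually_lt_const (half_pos hε)).and (eventually_gt_atTop 0)).exists
  refine ⟨M, ?_⟩
  have hε2 : (0 : ℝ≥0∞) < ENNReal.ofReal (ε / 2) := ENNReal.ofReal_pos.mpr (half_pos hε)
  filter_upwards [ht.eventually_lt_const hε2, eventually_ge_atTop 2] with n hn1 hn2
  have h2 := HasChebyshevRate.sqrt_mul_le hC hn2 (div_pos hM0 hK)
  calc P {ω | M < |Real.sqrt n * (Y n ω - f t)|}
      ≤ P ({ω | δ ≤ ‖X n ω - t‖} ∪ {ω | M / K ≤ Real.sqrt n * ‖X n ω - t‖}) := by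
        refine measure_mono fun ω hω => ?_
        simp only [Set.mem_ofPred_eq, Set.mem_union] at *
        by_contra! hc
        have h3 := hb (y := X n ω) (by rw [dist_eq_norm]; exact hc.1)
        rw [hY n hn2, abs_mul, abs_of_nonneg (Real.sqrt_nonneg _)] at hω
        rw [Real.norm_eq_abs] at h3
        have h4 := hc.2
        rw [lt_div_iff₀ hK] at h4
        have h5 := mul_le_mul_of_nonneg_left h3 (Real.sqrt_nonneg (n : ℝ))
        linarith
    _ ≤ ENNReal.ofReal (ε / 2) + ENNReal.ofReal (ε / 2) := by
        refine (measure_union_le _ _).trans (add_le_add hn1.le (h2.trans ?_))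
        apply ENNReal.ofReal_le_ofReal
        rw [div_pow, div_div_eq_mul_div]
        exact hMε.le
    _ = ENNReal.ofReal ε := by
        rw [← ENNReal.ofReal_add (half_pos hε).le (half_pos hε).le, add_halves]

/-- **Delta method**: the linearization error, scaled by `√n`, tends to `0` in probability. -/
lemma HasChebyshevRate.tendstoInMeasure_linearization {X : ℕ → Ω → E} {t : E}
    (hX : HasChebyshevRate P X t) {f : E → ℝ} {f' : E →L[ℝ] ℝ} (hf : HasFDerivAt f f' t)
    {Y : ℕ → Ω → ℝ} (hY : ∀ n, 2 ≤ n → ∀ ω, Y n ω = f (X n ω)) :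
    TendstoInMeasure P (fun (n : ℕ) ω => Real.sqrt n * (Y n ω - f t - f' (X n ω - t)))
      atTop 0 := by
  rw [tendstoInMeasure_iff_norm]
  intro ε hε
  rw [ENNReal.tendsto_nhds_zero]
  intro η hη
  by_cases htop : η = ∞
  · simp [htop]
  have hη' : 0 < η.toReal := ENNReal.toReal_pos hη.ne' htop
  have hX' := hX
  obtain ⟨C, hC0, hC⟩ := hX
  have hM : Tendsto (fun M : ℝ => C / M ^ 2) atTop (𝓝 0) :=
    tendsto_const_nhds.div_atTop (tendsto_pow_atTop two_ne_zero)
  obtain ⟨M, hMη, hM0⟩ :=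
    ((hM.eventually_lt_const (half_pos hη')).and (eventually_gt_atTop 0)).exists
  have hlin := hf.isLittleO.def (div_pos hε (by positivity : 0 < 2 * M))
  rw [Metric.eventually_nhds_iff] at hlin
  obtain ⟨δ, hδ, hb⟩ := hlin
  have hη2 : (0 : ℝ≥0∞) < ENNReal.ofReal (η.toReal / 2) := ENNReal.ofReal_pos.mpr (half_pos hη')
  filter_upwards [(hX'.tendsto hδ).eventually_lt_const hη2, eventually_ge_atTop 2] with n hn1 hn2
  have h2 := HasChebyshevRate.sqrt_mul_le hC hn2 hM0
  calc P {ω | ε ≤ ‖Real.sqrt n * (Y n ω - f t - f' (X n ω - t)) - (0 : Ω → ℝ) ω‖}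
      ≤ P ({ω | δ ≤ ‖X n ω - t‖} ∪ {ω | M ≤ Real.sqrt n * ‖X n ω - t‖}) := by
        refine measure_mono fun ω hω => ?_
        simp only [Set.mem_ofPred_eq, Set.mem_union, Pi.zero_apply, sub_zero] at *
        by_contra! hc
        have h3 := hb (y := X n ω) (by rw [dist_eq_norm]; exact hc.1)
        rw [hY n hn2, norm_mul, Real.norm_of_nonneg (Real.sqrt_nonneg _)] at hω
        have h5 := mul_le_mul_of_nonneg_left h3 (Real.sqrt_nonneg (n : ℝ))
        have h6 : ε / (2 * M) * (Real.sqrt n * ‖X n ω - t‖) ≤ ε / (2 * M) * M :=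
          mul_le_mul_of_nonneg_left hc.2.le (by positivity)
        have h7 : ε / (2 * M) * M = ε / 2 := by field_simp
        linarith
    _ ≤ ENNReal.ofReal (η.toReal / 2) + ENNReal.ofReal (η.toReal / 2) := by
        refine (measure_union_le _ _).trans (add_le_add hn1.le (h2.trans ?_))
        exact ENNReal.ofReal_le_ofReal hMη.le
    _ = η := by
        rw [← ENNReal.ofReal_add (half_pos hη').le (half_pos hη').le, add_halves,
          ENNReal.ofReal_toReal htop]

/-- A bounded `√n`-consistent estimator is asymptotically unbiased. -/
lemma IsRootNConsistent.tendsto_integral [IsProbabilityMeasure P] {Y : ℕ → Ω → ℝ} {θ B : ℝ}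
    (hY : IsRootNConsistent P Y θ) (hm : ∀ n, AEMeasurable (Y n) P)
    (hB : ∀ n ω, |Y n ω - θ| ≤ B) :
    Tendsto (fun n => ∫ ω, Y n ω ∂P) atTop (𝓝 θ) := by
  have hconv : TendstoInMeasure P (fun n ω => Y n ω - θ) atTop 0 := by
    rw [tendstoInMeasure_iff_norm]
    intro δ hδ
    rw [ENNReal.tendsto_nhds_zero]
    intro η hη
    by_cases htop : η = ∞
    · simp [htop]
    obtain ⟨M, hM⟩ := hY η.toReal (ENNReal.toReal_pos hη.ne' htop)
    have hsq : Tendsto (fun n : ℕ => Real.sqrt n * δ) atTop atTop :=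
      (Real.tendsto_sqrt_atTop.comp tendsto_natCast_atTop_atTop).atTop_mul_const hδ
    filter_upwards [hM, hsq.eventually_gt_atTop M] with n hn1 hn2
    rw [ENNReal.ofReal_toReal htop] at hn1
    refine (measure_mono fun ω hω => ?_).trans hn1
    simp only [Set.mem_ofPred_eq, Pi.zero_apply, sub_zero, Real.norm_eq_abs] at *
    rw [abs_mul, abs_of_nonneg (Real.sqrt_nonneg _)]
    exact hn2.trans_le (mul_le_mul_of_nonneg_left hω (Real.sqrt_nonneg _))
  have hint : ∀ n, Integrable (fun ω => Y n ω - θ) P := fun n =>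
    Integrable.of_bound ((hm n).sub_const θ).aestronglyMeasurable B (ae_of_all _ (hB n))
  have h0 : Tendsto (fun n => ∫ ω, (Y n ω - θ) ∂P) atTop (𝓝 0) := by
    refine tendsto_of_subseq_tendsto fun ns hns => ?_
    obtain ⟨ms, -, hms⟩ := (hconv.comp hns).exists_seq_tendsto_ae'
    refine ⟨ms, ?_⟩
    have h := tendsto_integral_of_dominated_convergence (fun _ => B)
      (fun k => (hint (ns (ms k))).aestronglyMeasurable) (integrable_const B)
      (fun k => ae_of_all _ (hB (ns (ms k)))) hms
    simpa using h
  have h1 : ∀ n, ∫ ω, Y n ω ∂P = ∫ ω, (Y n ω - θ) ∂P + θ := by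
    intro n
    have h := integral_add (hint n) (integrable_const θ)
    simpa using h
  simp_rw [h1]
  simpa using h0.add_const θ

end DeltaMethod

/-! ### The sample Gini correlation lies in `[-1, 1]` -/

lemma sampleGiniSum_eq_sum_kernel (a b : Fin 2) (z : ℕ → EuclideanSpace ℝ (Fin 2)) (n : ℕ) :
    sampleGiniSum a b z n
      = ∑ j ∈ Finset.range n, ∑ i ∈ Finset.range j, giniKernel a b (z i - z j) := rfl

/-- The Cauchy-Schwarz inequality for the sums over pairs with weights `1 / ‖z_i - z_j‖`. -/
lemma sampleGiniCorr_mem_Icc (z : ℕ → EuclideanSpace ℝ (Fin 2)) (n : ℕ) :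
    sampleGiniCorr z n ∈ Set.Icc (-1 : ℝ) 1 := by
  have hsum : ∀ a b, sampleGiniSum a b z n
      = ∑ p ∈ ltPairs n, (z p.2 a - z p.1 a) / Real.sqrt ‖z p.2 - z p.1‖
        * ((z p.2 b - z p.1 b) / Real.sqrt ‖z p.2 - z p.1‖) := by
    intro a b
    have h := Finset.sum_sigma (Finset.range n) Finset.range fun p : Σ _ : ℕ, ℕ =>
      (z p.2 a - z p.1 a) * (z p.2 b - z p.1 b) / ‖z p.2 - z p.1‖
    rw [sampleGiniSum, ← h]
    refine Finset.sum_congr rfl fun p _ => ?_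
    rw [div_mul_div_comm, Real.mul_self_sqrt (norm_nonneg _)]
  have hcs := Finset.sum_mul_sq_le_sq_mul_sq (ltPairs n)
    (fun p => (z p.2 0 - z p.1 0) / Real.sqrt ‖z p.2 - z p.1‖)
    (fun p => (z p.2 1 - z p.1 1) / Real.sqrt ‖z p.2 - z p.1‖)
  simp only [sq (_ / _)] at hcs
  rw [← hsum, ← hsum, ← hsum] at hcs
  have h0 : 0 ≤ sampleGiniSum 0 0 z n := by
    rw [hsum]
    exact Finset.sum_nonneg fun _ _ => mul_self_nonneg _
  rw [Set.mem_Icc, ← abs_le, sampleGiniCorr, ← Real.sqrt_mul h0, abs_div,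
    abs_of_nonneg (Real.sqrt_nonneg _)]
  exact div_le_one_of_le₀ (Real.abs_le_sqrt hcs) (Real.sqrt_nonneg _)

/-! ### Hoeffding decomposition of the sample Gini covariances -/

/-- The degenerate part of the Gini kernel in its Hoeffding decomposition. -/
noncomputable def giniDegenerate (a b : Fin 2) (H : Measure (EuclideanSpace ℝ (Fin 2)))
    (p : EuclideanSpace ℝ (Fin 2) × EuclideanSpace ℝ (Fin 2)) : ℝ :=
  giniKernel a b (p.1 - p.2) - giniProj a b H p.1 - giniProj a b H p.2 + giniCov a b H

/-- The sum of the degenerate kernel over all pairs of observations. -/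
noncomputable def giniDegenerateSum (a b : Fin 2) (H : Measure (EuclideanSpace ℝ (Fin 2)))
    (z : ℕ → EuclideanSpace ℝ (Fin 2)) (n : ℕ) : ℝ :=
  ∑ j ∈ Finset.range n, ∑ i ∈ Finset.range j, giniDegenerate a b H (z i, z j)

/-- The sample Gini covariance as a U-statistic, an unbiased estimator of `giniCov a b H`. -/
noncomputable def sampleGiniCov (a b : Fin 2) (z : ℕ → EuclideanSpace ℝ (Fin 2)) (n : ℕ) : ℝ :=
  2 / (n * (n - 1)) * sampleGiniSum a b z n

/-- Each observation occurs in `n - 1` of the pairs. -/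
lemma giniDegenerateSum_eq (a b : Fin 2) (H : Measure (EuclideanSpace ℝ (Fin 2)))
    (z : ℕ → EuclideanSpace ℝ (Fin 2)) (n : ℕ) :
    giniDegenerateSum a b H z n = sampleGiniSum a b z n
      - (n - 1) * ∑ i ∈ Finset.range n, giniProj a b H (z i) + n * (n - 1) / 2 * giniCov a b H := by
  rw [giniDegenerateSum, sampleGiniSum_eq_sum_kernel]
  induction n with
  | zero => simp
  | succ n ih =>
    rw [Finset.sum_range_succ, ih, Finset.sum_range_succ (fun j => ∑ i ∈ Finset.range j, _),
      Finset.sum_range_succ (fun i => giniProj a b H (z i))]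
    simp only [giniDegenerate, Finset.sum_add_distrib, Finset.sum_sub_distrib, Finset.sum_const,
      Finset.card_range, nsmul_eq_mul]
    push_cast
    ring

/-- The Hoeffding decomposition of the sample Gini covariance. -/
lemma sampleGiniCov_sub (a b : Fin 2) (H : Measure (EuclideanSpace ℝ (Fin 2)))
    (z : ℕ → EuclideanSpace ℝ (Fin 2)) {n : ℕ} (hn : 2 ≤ n) :
    sampleGiniCov a b z n - giniCov a b H = 2 / (n * (n - 1)) * giniDegenerateSum a b H z n
      + (n : ℝ)⁻¹ * ∑ i ∈ Finset.range n, giniCovInfluence a b H (z i) := by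
  have h1 : (n : ℝ) ≠ 0 := by positivity
  have h2 : (n : ℝ) - 1 ≠ 0 := by
    have : (2 : ℝ) ≤ n := by exact_mod_cast hn
    linarith
  rw [sampleGiniCov, giniDegenerateSum_eq]
  simp only [giniCovInfluence, Finset.sum_sub_distrib, ← Finset.mul_sum, Finset.sum_const,
    Finset.card_range, nsmul_eq_mul]
  field_simp
  ring

lemma giniDegenerate_swap (a b : Fin 2) (H : Measure (EuclideanSpace ℝ (Fin 2)))
    (x y : EuclideanSpace ℝ (Fin 2)) :
    giniDegenerate a b H (x, y) = giniDegenerate a b H (y, x) := by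
  simp only [giniDegenerate]
  rw [giniKernel_sub_comm]
  ring

lemma memLp_comp_of_hasLaw {Ω : Type*} [MeasurableSpace Ω] {P : Measure Ω}
    {H : Measure (EuclideanSpace ℝ (Fin 2))} {Z : ℕ → Ω → EuclideanSpace ℝ (Fin 2)}
    {ψ : EuclideanSpace ℝ (Fin 2) → ℝ} (hψ : MemLp ψ 2 H)
    (hlaw : ∀ i, HasLaw (Z i) H P) (i : ℕ) : MemLp (fun ω => ψ (Z i ω)) 2 P := by
  rw [← (hlaw i).map_eq] at hψ
  exact hψ.comp_of_map (hlaw i).aemeasurable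

section Hoeffding

variable {H : Measure (EuclideanSpace ℝ (Fin 2))} [IsProbabilityMeasure H]

@[fun_prop]
lemma measurable_giniDegenerate (a b : Fin 2) : Measurable (giniDegenerate a b H) := by
  unfold giniDegenerate
  fun_prop

@[fun_prop]
lemma measurable_giniCovInfluence (a b : Fin 2) : Measurable (giniCovInfluence a b H) := by
  unfold giniCovInfluence
  fun_prop

@[fun_prop]
lemma measurable_giniCorrInfluence : Measurable (giniCorrInfluence H) := by
  unfold giniCorrInfluence
  fun_prop

lemma integral_giniDegenerate (hH : Integrable (fun z => ‖z‖) H) (a b : Fin 2)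
    (x : EuclideanSpace ℝ (Fin 2)) : ∫ y, giniDegenerate a b H (x, y) ∂H = 0 := by
  have h1 := integrable_giniKernel_sub hH a b x
  have h2 := integrable_giniProj hH a b
  simp only [giniDegenerate]
  rw [integral_add ((h1.sub' (integrable_const _)).sub' h2) (integrable_const _),
    integral_sub (h1.sub' (integrable_const _)) h2, integral_sub h1 (integrable_const _),
    ← giniCov_eq hH, ← giniProj]
  simp

lemma memLp_giniDegenerate (hH : MemLp (fun z => ‖z‖) 2 H) (a b : Fin 2) :
    MemLp (giniDegenerate a b H) 2 (H.prod H) := by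
  have hφ := memLp_giniProj hH a b
  have hK : MemLp (fun p : EuclideanSpace ℝ (Fin 2) × EuclideanSpace ℝ (Fin 2) =>
      giniKernel a b (p.1 - p.2)) 2 (H.prod H) := by
    refine ((hH.comp_measurePreserving measurePreserving_fst).add
      (hH.comp_measurePreserving measurePreserving_snd)).mono
        (by fun_prop : Measurable fun p : EuclideanSpace ℝ (Fin 2) × EuclideanSpace ℝ (Fin 2) =>
          giniKernel a b (p.1 - p.2)).aestronglyMeasurable (ae_of_all _ fun p => ?_)
    exact ((abs_giniKernel_le a b _).trans (norm_sub_le p.1 p.2)).trans (le_abs_self _)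
  exact ((hK.sub (hφ.comp_measurePreserving measurePreserving_fst)).sub
    (hφ.comp_measurePreserving measurePreserving_snd)).add (memLp_const _)

variable {Ω : Type*} [MeasurableSpace Ω] {P : Measure Ω} [IsProbabilityMeasure P]
  {Z : ℕ → Ω → EuclideanSpace ℝ (Fin 2)}

lemma memLp_giniDegenerateSum (hH : MemLp (fun z => ‖z‖) 2 H) (hlaw : ∀ i, HasLaw (Z i) H P)
    (hindep : iIndepFun Z P) (a b : Fin 2) (n : ℕ) :
    MemLp (fun ω => giniDegenerateSum a b H (fun i => Z i ω) n) 2 P := by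
  unfold giniDegenerateSum
  refine memLp_finsetSum _ fun j _ => memLp_finsetSum _ fun i hi => ?_
  exact memLp_pair hlaw hindep (memLp_giniDegenerate hH a b) (Finset.mem_range.mp hi).ne

lemma integral_sq_giniDegenerateSum (hH : MemLp (fun z => ‖z‖) 2 H)
    (hlaw : ∀ i, HasLaw (Z i) H P) (hindep : iIndepFun Z P) (a b : Fin 2) (n : ℕ) :
    ∫ ω, giniDegenerateSum a b H (fun i => Z i ω) n ^ 2 ∂P
      = n * (n - 1) / 2 * ∫ p, giniDegenerate a b H p ^ 2 ∂(H.prod H) :=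
  integral_sq_sum_degenerate hlaw hindep (measurable_giniDegenerate a b)
    (giniDegenerate_swap a b H) (integral_giniDegenerate (hH.integrable (by norm_num)) a b)
    (memLp_giniDegenerate hH a b) n

/-- The degenerate part of the Hoeffding decomposition is negligible at the scale `√n`. -/
lemma tendstoInMeasure_giniDegenerateSum (hH : MemLp (fun z => ‖z‖) 2 H)
    (hlaw : ∀ i, HasLaw (Z i) H P) (hindep : iIndepFun Z P) (a b : Fin 2) (c : ℝ) :
    TendstoInMeasure P (fun (n : ℕ) ω => c * (Real.sqrt n *
      (2 / (n * (n - 1)) * giniDegenerateSum a b H (fun i => Z i ω) n))) atTop 0 := by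
  refine tendstoInMeasure_zero_of_integral_sq (fun n =>
    (((memLp_giniDegenerateSum hH hlaw hindep a b n).const_mul _).const_mul _).const_mul _) ?_
  set v := ∫ p, giniDegenerate a b H p ^ 2 ∂(H.prod H) with hv
  have hlim : Tendsto (fun n : ℕ => 2 * c ^ 2 * v / ((n : ℝ) - 1)) atTop (𝓝 0) :=
    tendsto_const_nhds.div_atTop
      (tendsto_atTop_add_const_right _ (-1) tendsto_natCast_atTop_atTop)
  refine hlim.congr' ?_
  filter_upwards [eventually_ge_atTop 2] with n hn
  have h2 : (2 : ℝ) ≤ n := by exact_mod_cast hn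
  have h1 : (n : ℝ) ≠ 0 := by linarith
  have h3 : (n : ℝ) - 1 ≠ 0 := by linarith
  have hs := Real.sq_sqrt (Nat.cast_nonneg (α := ℝ) n)
  simp_rw [mul_pow]
  rw [integral_const_mul, integral_const_mul, integral_const_mul,
    integral_sq_giniDegenerateSum hH hlaw hindep, ← hv, hs]
  field_simp

lemma memLp_sampleGiniCov_sub (hH : MemLp (fun z => ‖z‖) 2 H)
    (hlaw : ∀ i, HasLaw (Z i) H P) (hindep : iIndepFun Z P) (a b : Fin 2) {n : ℕ} (hn : 2 ≤ n) :
    MemLp (fun ω => sampleGiniCov a b (fun i => Z i ω) n - giniCov a b H) 2 P := by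
  simp_rw [sampleGiniCov_sub a b H _ hn]
  exact ((memLp_giniDegenerateSum hH hlaw hindep a b n).const_mul _).add
    ((memLp_finsetSum _ fun i _ =>
      memLp_comp_of_hasLaw (memLp_giniCovInfluence hH a b) hlaw i).const_mul _)

lemma hasChebyshevRate_sampleGiniCov (hH : MemLp (fun z => ‖z‖) 2 H)
    (hlaw : ∀ i, HasLaw (Z i) H P) (hindep : iIndepFun Z P) (a b : Fin 2) :
    HasChebyshevRate P (fun n ω => sampleGiniCov a b (fun i => Z i ω) n) (giniCov a b H) := by
  set v := ∫ p, giniDegenerate a b H p ^ 2 ∂(H.prod H) with hv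
  set w := ∫ z, giniCovInfluence a b H z ^ 2 ∂H with hw
  have hv0 : 0 ≤ v := integral_nonneg fun _ => sq_nonneg _
  have hw0 : 0 ≤ w := integral_nonneg fun _ => sq_nonneg _
  refine ⟨4 * v + 2 * w, by positivity, fun n hn δ hδ => ?_⟩
  refine (measure_ge_le_of_integral_sq (memLp_sampleGiniCov_sub hH hlaw hindep a b hn) hδ).trans ?_
  apply ENNReal.ofReal_le_ofReal
  have h2 : (2 : ℝ) ≤ n := by exact_mod_cast hn
  rw [← div_div]
  gcongr
  simp_rw [sampleGiniCov_sub a b H _ hn]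
  have hA := (memLp_giniDegenerateSum hH hlaw hindep a b n).const_mul (2 / ((n : ℝ) * (n - 1)))
  have hB := (memLp_finsetSum (Finset.range n) fun i _ =>
      memLp_comp_of_hasLaw (P := P) (Z := Z) (memLp_giniCovInfluence hH a b) hlaw i).const_mul
        ((n : ℝ)⁻¹)
  calc ∫ ω, (2 / ((n : ℝ) * (n - 1)) * giniDegenerateSum a b H (fun i => Z i ω) n
          + (n : ℝ)⁻¹ * ∑ i ∈ Finset.range n, giniCovInfluence a b H (Z i ω)) ^ 2 ∂P
      ≤ ∫ ω, (2 * (2 / ((n : ℝ) * (n - 1)) * giniDegenerateSum a b H (fun i => Z i ω) n) ^ 2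
          + 2 * ((n : ℝ)⁻¹ * ∑ i ∈ Finset.range n, giniCovInfluence a b H (Z i ω)) ^ 2) ∂P := by
        refine integral_mono (hA.add hB).integrable_sq
          ((hA.integrable_sq.const_mul 2).fun_add (hB.integrable_sq.const_mul 2)) fun ω => ?_
        simp only
        nlinarith [sq_nonneg (2 / ((n : ℝ) * (n - 1)) * giniDegenerateSum a b H (fun i => Z i ω) n
          - (n : ℝ)⁻¹ * ∑ i ∈ Finset.range n, giniCovInfluence a b H (Z i ω))]
    _ = 2 * ((2 / ((n : ℝ) * (n - 1))) ^ 2 * (n * (n - 1) / 2 * v))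
          + 2 * ((n : ℝ)⁻¹ ^ 2 * (n * w)) := by
        rw [integral_add (hA.integrable_sq.const_mul 2) (hB.integrable_sq.const_mul 2)]
        simp_rw [mul_pow, integral_const_mul]
        rw [integral_sq_giniDegenerateSum hH hlaw hindep,
          integral_sq_sum_iid hlaw hindep (measurable_giniCovInfluence a b)
            (memLp_giniCovInfluence hH a b)
            (integral_giniCovInfluence (hH.integrable (by norm_num)) a b)]
    _ = (4 * v / (n - 1) + 2 * w) / n := by
        have h1 : (n : ℝ) ≠ 0 := by linarith
        have h3 : (n : ℝ) - 1 ≠ 0 := by linarith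
        field_simp
        ring
    _ ≤ (4 * v + 2 * w) / n := by
        gcongr
        exact div_le_self (by positivity) (by linarith)

end Hoeffding

/-! ### The estimator as a function of the sample Gini covariances -/

/-- The Gini correlation as a function of the Gini covariances `(T₁, T₂, T₃)`. -/
noncomputable def giniRatio (t : ℝ × ℝ × ℝ) : ℝ :=
  t.2.1 / (Real.sqrt t.1 * Real.sqrt t.2.2)

lemma giniRatio_sampleGiniCov (z : ℕ → EuclideanSpace ℝ (Fin 2)) {n : ℕ} (hn : 2 ≤ n) :
    giniRatio (sampleGiniCov 0 0 z n, sampleGiniCov 0 1 z n, sampleGiniCov 1 1 z n)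
      = sampleGiniCorr z n := by
  have h2 : (2 : ℝ) ≤ n := by exact_mod_cast hn
  have hc : 0 < 2 / ((n : ℝ) * (n - 1)) :=
    div_pos two_pos (mul_pos (by linarith) (by linarith))
  simp only [giniRatio, sampleGiniCov, sampleGiniCorr]
  rw [Real.sqrt_mul hc.le, Real.sqrt_mul hc.le, mul_mul_mul_comm, Real.mul_self_sqrt hc.le,
    mul_div_mul_left _ _ hc.ne']

/-- The derivative of `giniRatio` at the point `(T₁, T₂, T₃)`. -/
noncomputable def giniRatioDeriv (t : ℝ × ℝ × ℝ) : ℝ × ℝ × ℝ →L[ℝ] ℝ :=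
  (-(giniRatio t / (2 * t.1))) • ContinuousLinearMap.fst ℝ ℝ (ℝ × ℝ)
    + (Real.sqrt t.1 * Real.sqrt t.2.2)⁻¹ •
      (ContinuousLinearMap.fst ℝ ℝ ℝ ∘L ContinuousLinearMap.snd ℝ ℝ (ℝ × ℝ))
    + (-(giniRatio t / (2 * t.2.2))) •
      (ContinuousLinearMap.snd ℝ ℝ ℝ ∘L ContinuousLinearMap.snd ℝ ℝ (ℝ × ℝ))

lemma hasFDerivAt_giniRatio {t : ℝ × ℝ × ℝ} (h0 : 0 < t.1) (h1 : 0 < t.2.2) :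
    HasFDerivAt giniRatio (giniRatioDeriv t) t := by
  have hs0 := Real.sqrt_pos.mpr h0
  have hs1 := Real.sqrt_pos.mpr h1
  have e0 := Real.sq_sqrt h0.le
  have e1 := Real.sq_sqrt h1.le
  have d0 : HasFDerivAt (fun t : ℝ × ℝ × ℝ => t.1) (ContinuousLinearMap.fst ℝ ℝ (ℝ × ℝ)) t :=
    hasFDerivAt_fst
  have d1 : HasFDerivAt (fun t : ℝ × ℝ × ℝ => t.2.1)
      (ContinuousLinearMap.fst ℝ ℝ ℝ ∘L ContinuousLinearMap.snd ℝ ℝ (ℝ × ℝ)) t :=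
    hasFDerivAt_fst.comp t hasFDerivAt_snd
  have d2 : HasFDerivAt (fun t : ℝ × ℝ × ℝ => t.2.2)
      (ContinuousLinearMap.snd ℝ ℝ ℝ ∘L ContinuousLinearMap.snd ℝ ℝ (ℝ × ℝ)) t :=
    hasFDerivAt_snd.comp t hasFDerivAt_snd
  have dinv := (hasDerivAt_inv (mul_pos hs0 hs1).ne').comp_hasFDerivAt t
    ((d0.sqrt h0.ne').mul (d2.sqrt h1.ne'))
  refine (d1.mul dinv).congr_fderiv ?_
  ext <;> simp [giniRatioDeriv, giniRatio]
  · rw [show 2 * t.1 = 2 * Real.sqrt t.1 ^ 2 by rw [e0]]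
    field_simp
  · rw [show 2 * t.2.2 = 2 * Real.sqrt t.2.2 ^ 2 by rw [e1]]
    field_simp

/-! ### Asymptotics of the estimator -/

/-- The vector `(T₁, T₂, T₃)` of Gini covariances. -/
noncomputable def giniCovVec (H : Measure (EuclideanSpace ℝ (Fin 2))) : ℝ × ℝ × ℝ :=
  (giniCov 0 0 H, giniCov 0 1 H, giniCov 1 1 H)

/-- The vector of sample Gini covariances. -/
noncomputable def sampleGiniCovVec (z : ℕ → EuclideanSpace ℝ (Fin 2)) (n : ℕ) : ℝ × ℝ × ℝ :=
  (sampleGiniCov 0 0 z n, sampleGiniCov 0 1 z n, sampleGiniCov 1 1 z n)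

lemma giniRatio_giniCovVec (H : Measure (EuclideanSpace ℝ (Fin 2))) :
    giniRatio (giniCovVec H) = giniCorr H := rfl

lemma giniRatioDeriv_apply (H : Measure (EuclideanSpace ℝ (Fin 2))) (v : ℝ × ℝ × ℝ) :
    giniRatioDeriv (giniCovVec H) v
      = -(giniCorr H / (2 * giniCov 0 0 H)) * v.1
        + (Real.sqrt (giniCov 0 0 H) * Real.sqrt (giniCov 1 1 H))⁻¹ * v.2.1
        + -(giniCorr H / (2 * giniCov 1 1 H)) * v.2.2 := rfl

lemma giniRatioDeriv_giniCovInfluence (H : Measure (EuclideanSpace ℝ (Fin 2)))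
    (z : EuclideanSpace ℝ (Fin 2)) :
    giniRatioDeriv (giniCovVec H)
        (giniCovInfluence 0 0 H z, giniCovInfluence 0 1 H z, giniCovInfluence 1 1 H z)
      = giniCorrInfluence H z := by
  rw [giniRatioDeriv_apply, giniCorrInfluence]
  ring

lemma hasFDerivAt_giniLinkInv_giniRatio {H : Measure (EuclideanSpace ℝ (Fin 2))} {ρ : ℝ}
    (hρ : |ρ| < 1) (hcorr : giniCorr H = giniLink ρ)
    (h0 : 0 < giniCov 0 0 H) (h1 : 0 < giniCov 1 1 H) :
    HasFDerivAt (fun t => giniLinkInv (giniRatio t))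
      ((giniLinkDeriv ρ)⁻¹ • giniRatioDeriv (giniCovVec H)) (giniCovVec H) := by
  have hk := hasDerivAt_giniLinkInv hρ
  rw [← hcorr, ← giniRatio_giniCovVec] at hk
  exact hk.comp_hasFDerivAt (giniCovVec H) (hasFDerivAt_giniRatio h0 h1)

lemma giniLinkInv_giniRatio_giniCovVec {H : Measure (EuclideanSpace ℝ (Fin 2))} {ρ : ℝ}
    (hρ : |ρ| < 1) (hcorr : giniCorr H = giniLink ρ) :
    giniLinkInv (giniRatio (giniCovVec H)) = ρ := by
  rw [giniRatio_giniCovVec, hcorr, giniLinkInv_giniLink (mem_Icc_of_abs_lt_one hρ)]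

lemma giniLinearCorrEst_eq (z : ℕ → EuclideanSpace ℝ (Fin 2)) {n : ℕ} (hn : 2 ≤ n) :
    giniLinearCorrEst z n = giniLinkInv (giniRatio (sampleGiniCovVec z n)) := by
  rw [giniLinearCorrEst, sampleGiniCovVec, giniRatio_sampleGiniCov z hn]

lemma giniLinearCorrEst_mem_Icc (z : ℕ → EuclideanSpace ℝ (Fin 2)) (n : ℕ) :
    giniLinearCorrEst z n ∈ Set.Icc (-1 : ℝ) 1 :=
  giniLinkInv_mem (sampleGiniCorr_mem_Icc z n)

lemma aemeasurable_giniLinearCorrEst {Ω : Type*} [MeasurableSpace Ω] {P : Measure Ω}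
    {H : Measure (EuclideanSpace ℝ (Fin 2))} {Z : ℕ → Ω → EuclideanSpace ℝ (Fin 2)}
    (hlaw : ∀ i, HasLaw (Z i) H P) (n : ℕ) :
    AEMeasurable (fun ω => giniLinearCorrEst (fun i => Z i ω) n) P := by
  have hs : ∀ a b, AEMeasurable (fun ω => sampleGiniSum a b (fun i => Z i ω) n) P := by
    intro a b
    simp_rw [sampleGiniSum_eq_sum_kernel]
    refine Finset.aemeasurable_fun_sum _ fun j _ => Finset.aemeasurable_fun_sum _ fun i _ => ?_
    exact (measurable_giniKernel a b).comp_aemeasurable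
      ((hlaw i).aemeasurable.sub (hlaw j).aemeasurable)
  have hc : AEMeasurable (fun ω => sampleGiniCorr (fun i => Z i ω) n) P :=
    (hs 0 1).div ((hs 0 0).sqrt.mul (hs 1 1).sqrt)
  refine (measurable_giniLinkInv_projIcc.comp_aemeasurable hc).congr (ae_of_all _ fun ω => ?_)
  simp only [Function.comp_apply, giniLinearCorrEst]
  rw [Set.projIcc_of_mem _ (sampleGiniCorr_mem_Icc _ n)]

/-- The linear term of the delta method is a normalized sum of influence functions plus
degenerate U-statistics. -/
lemma sqrt_mul_giniRatioDeriv (H : Measure (EuclideanSpace ℝ (Fin 2)))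
    (z : ℕ → EuclideanSpace ℝ (Fin 2)) {n : ℕ} (hn : 2 ≤ n) (κ : ℝ) :
    Real.sqrt n * (κ * giniRatioDeriv (giniCovVec H) (sampleGiniCovVec z n - giniCovVec H))
      = κ * -(giniCorr H / (2 * giniCov 0 0 H))
          * (Real.sqrt n * (2 / (n * (n - 1)) * giniDegenerateSum 0 0 H z n))
        + κ * (Real.sqrt (giniCov 0 0 H) * Real.sqrt (giniCov 1 1 H))⁻¹
          * (Real.sqrt n * (2 / (n * (n - 1)) * giniDegenerateSum 0 1 H z n))
        + κ * -(giniCorr H / (2 * giniCov 1 1 H))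
          * (Real.sqrt n * (2 / (n * (n - 1)) * giniDegenerateSum 1 1 H z n))
        + (Real.sqrt n)⁻¹ * ∑ i ∈ Finset.range n, κ * giniCorrInfluence H (z i) := by
  have hn0 : (0 : ℝ) < n := by positivity
  have hs := Real.sqrt_pos.mpr hn0
  have hinv : (n : ℝ)⁻¹ = (Real.sqrt n)⁻¹ ^ 2 := by
    rw [inv_pow, Real.sq_sqrt hn0.le]
  have e : sampleGiniCovVec z n - giniCovVec H
      = (sampleGiniCov 0 0 z n - giniCov 0 0 H, sampleGiniCov 0 1 z n - giniCov 0 1 H,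
        sampleGiniCov 1 1 z n - giniCov 1 1 H) := rfl
  have hsum : ∑ i ∈ Finset.range n, κ * giniCorrInfluence H (z i)
      = κ * (-(giniCorr H / (2 * giniCov 0 0 H))
            * ∑ i ∈ Finset.range n, giniCovInfluence 0 0 H (z i)
          + (Real.sqrt (giniCov 0 0 H) * Real.sqrt (giniCov 1 1 H))⁻¹
            * ∑ i ∈ Finset.range n, giniCovInfluence 0 1 H (z i)
          + -(giniCorr H / (2 * giniCov 1 1 H))
            * ∑ i ∈ Finset.range n, giniCovInfluence 1 1 H (z i)) := by
    simp only [Finset.mul_sum, ← Finset.sum_add_distrib]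
    refine Finset.sum_congr rfl fun i _ => ?_
    rw [← giniRatioDeriv_giniCovInfluence, giniRatioDeriv_apply]
  rw [hsum, e, giniRatioDeriv_apply, sampleGiniCov_sub 0 0 H z hn, sampleGiniCov_sub 0 1 H z hn,
    sampleGiniCov_sub 1 1 H z hn, hinv]
  field_simp
  ring

section Asymptotics

variable {Ω : Type*} [MeasurableSpace Ω] {P : Measure Ω} [IsProbabilityMeasure P]
  {H : Measure (EuclideanSpace ℝ (Fin 2))} [IsProbabilityMeasure H]
  {Z : ℕ → Ω → EuclideanSpace ℝ (Fin 2)} {ρ : ℝ}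

lemma hasChebyshevRate_sampleGiniCovVec (hH : MemLp (fun z => ‖z‖) 2 H)
    (hlaw : ∀ i, HasLaw (Z i) H P) (hindep : iIndepFun Z P) :
    HasChebyshevRate P (fun n ω => sampleGiniCovVec (fun i => Z i ω) n) (giniCovVec H) :=
  (hasChebyshevRate_sampleGiniCov hH hlaw hindep 0 0).prodMk
    ((hasChebyshevRate_sampleGiniCov hH hlaw hindep 0 1).prodMk
      (hasChebyshevRate_sampleGiniCov hH hlaw hindep 1 1))

lemma isRootNConsistent_giniLinearCorrEst (hH : MemLp (fun z => ‖z‖) 2 H)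
    (hlaw : ∀ i, HasLaw (Z i) H P) (hindep : iIndepFun Z P)
    (hρ : |ρ| < 1) (hcorr : giniCorr H = giniLink ρ)
    (h0 : 0 < giniCov 0 0 H) (h1 : 0 < giniCov 1 1 H) :
    IsRootNConsistent P (fun n ω => giniLinearCorrEst (fun i => Z i ω) n) ρ := by
  have h := (hasChebyshevRate_sampleGiniCovVec hH hlaw hindep).isRootNConsistent
    (hasFDerivAt_giniLinkInv_giniRatio hρ hcorr h0 h1)
    (Y := fun n ω => giniLinearCorrEst (fun i => Z i ω) n)
    (fun n hn ω => giniLinearCorrEst_eq _ hn)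
  simpa only [giniLinkInv_giniRatio_giniCovVec hρ hcorr] using h

/-- Asymptotic normality: the delta method reduces the claim to the central limit theorem for the
influence functions of the Gini correlation. -/
lemma tendstoInDistribution_giniLinearCorrEst (hH : MemLp (fun z => ‖z‖) 2 H)
    (hlaw : ∀ i, HasLaw (Z i) H P) (hindep : iIndepFun Z P)
    (hρ : |ρ| < 1) (hcorr : giniCorr H = giniLink ρ)
    (h0 : 0 < giniCov 0 0 H) (h1 : 0 < giniCov 1 1 H) :
    TendstoInDistribution
      (fun (n : ℕ) ω => Real.sqrt n * (giniLinearCorrEst (fun i => Z i ω) n - ρ))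
      atTop id (fun _ => P)
      (gaussianReal 0 (Real.toNNReal
        ((1 / giniLinkDeriv ρ) ^ 2 * ∫ z, giniCorrInfluence H z ^ 2 ∂H))) := by
  set κ := (giniLinkDeriv ρ)⁻¹ with hκ
  set ψ : EuclideanSpace ℝ (Fin 2) → ℝ := fun z => κ * giniCorrInfluence H z with hψ
  have hψm : Measurable ψ := by fun_prop
  have hψ2 : MemLp ψ 2 H := (memLp_giniCorrInfluence hH).const_mul κ
  have hψ0 : ∫ z, ψ z ∂H = 0 := by
    rw [hψ, integral_const_mul, integral_giniCorrInfluence (hH.integrable (by norm_num)), mul_zero]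
  have hX0 : ∫ ω, ψ (Z 0 ω) ∂P = 0 := by
    have h := (hlaw 0).integral_comp (f := ψ) hψm.aestronglyMeasurable
    exact h.trans hψ0
  have hvar : Var[fun ω => ψ (Z 0 ω); P]
      = (1 / giniLinkDeriv ρ) ^ 2 * ∫ z, giniCorrInfluence H z ^ 2 ∂H := by
    rw [variance_of_integral_eq_zero (X := fun ω => ψ (Z 0 ω))
      (hψm.comp_aemeasurable (hlaw 0).aemeasurable) hX0]
    have h := (hlaw 0).integral_comp (f := fun z => ψ z ^ 2) (hψm.pow_const 2).aestronglyMeasurable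
    refine h.trans ?_
    simp only [hψ, mul_pow, integral_const_mul, one_div, hκ]
  have hclt := tendstoInDistribution_inv_sqrt_mul_sum_sub (P := P)
    (P' := gaussianReal 0 (Real.toNNReal
        ((1 / giniLinkDeriv ρ) ^ 2 * ∫ z, giniCorrInfluence H z ^ 2 ∂H)))
    (X := fun i ω => ψ (Z i ω)) (Y := id) (by rw [hvar]; exact HasLaw.id)
    (memLp_comp_of_hasLaw hψ2 hlaw 0) (hindep.comp (fun _ => ψ) fun _ => hψm)
    (fun i => (⟨(hlaw i).aemeasurable, (hlaw 0).aemeasurable,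
      (hlaw i).map_eq.trans (hlaw 0).map_eq.symm⟩ : IdentDistrib (Z i) (Z 0) P P).comp hψm)
  simp only [hX0, mul_zero, sub_zero] at hclt
  refine tendstoInDistribution_of_tendstoInMeasure_sub _ _ hclt ?_ fun n =>
    ((aemeasurable_giniLinearCorrEst hlaw n).sub_const ρ).const_mul _
  have hdelta := (hasChebyshevRate_sampleGiniCovVec hH hlaw hindep).tendstoInMeasure_linearization
    (hasFDerivAt_giniLinkInv_giniRatio hρ hcorr h0 h1)
    (Y := fun n ω => giniLinearCorrEst (fun i => Z i ω) n)
    (fun n hn ω => giniLinearCorrEst_eq _ hn)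
  simp only [giniLinkInv_giniRatio_giniCovVec hρ hcorr] at hdelta
  have hrem := (((tendstoInMeasure_giniDegenerateSum hH hlaw hindep 0 0
      (κ * -(giniCorr H / (2 * giniCov 0 0 H)))).add_zero_real
    (tendstoInMeasure_giniDegenerateSum hH hlaw hindep 0 1
      (κ * (Real.sqrt (giniCov 0 0 H) * Real.sqrt (giniCov 1 1 H))⁻¹))).add_zero_real
    (tendstoInMeasure_giniDegenerateSum hH hlaw hindep 1 1
      (κ * -(giniCorr H / (2 * giniCov 1 1 H)))))
  refine (hdelta.add_zero_real hrem).congr' ?_ (ae_eq_refl _)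
  filter_upwards [eventually_ge_atTop 2] with n hn
  refine ae_of_all _ fun ω => ?_
  have h := sqrt_mul_giniRatioDeriv H (fun i => Z i ω) hn κ
  simp only [smul_apply, smul_eq_mul, Pi.sub_apply, hψ]
  linarith

end Asymptotics

theorem theorem5 {Ω : Type*} [MeasurableSpace Ω] (P : Measure Ω) [IsProbabilityMeasure P]
    (H : Measure (EuclideanSpace ℝ (Fin 2))) [IsProbabilityMeasure H]
    (m : EuclideanSpace ℝ (Fin 2)) (σ ρ : ℝ)
    (hH : IsElliptical H m (σ ^ 2 • !![1, ρ; ρ, 1]))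
    (hmom : Integrable (fun z => ‖z‖ ^ 2) H)
    (Z : ℕ → Ω → EuclideanSpace ℝ (Fin 2))
    (hlaw : ∀ i, HasLaw (Z i) H P) (hindep : iIndepFun Z P) :
    -- the inverse of `k` on `[-1, 1]` is well defined, and it is applied to points of `[-1, 1]`
    Set.BijOn giniLink (Set.Icc (-1) 1) (Set.Icc (-1) 1) ∧
    (∀ n ω, sampleGiniCorr (fun i => Z i ω) n ∈ Set.Icc (-1 : ℝ) 1) ∧
    -- the derivative of `k` at `ρ`
    (HasDerivAt giniLink (giniLinkDeriv ρ) ρ ∧ giniLinkDeriv ρ ≠ 0) ∧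
    -- `v_g` is well defined, and is given by its explicit expansion when `ρ ≠ 0`
    (HasInfluenceFunction giniCorr H (influenceFunction giniCorr H) ∧
      MemLp (influenceFunction giniCorr H) 2 H) ∧
    (∀ a b, HasInfluenceFunction (giniCov a b) H (influenceFunction (giniCov a b) H) ∧
      MemLp (influenceFunction (giniCov a b) H) 2 H) ∧
    (ρ ≠ 0 → giniCov 0 1 H ≠ 0 ∧ giniAsympVar H = giniAsympVarExpansion H) ∧
    (0 < giniCov 0 0 H ∧ 0 < giniCov 1 1 H) ∧
    -- asymptotic unbiasedness
    ((∀ n, Integrable (fun ω => giniLinearCorrEst (fun i => Z i ω) n) P) ∧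
      Tendsto (fun n => ∫ ω, giniLinearCorrEst (fun i => Z i ω) n ∂P) atTop (𝓝 ρ)) ∧
    -- `√n`-consistency
    IsRootNConsistent P (fun n ω => giniLinearCorrEst (fun i => Z i ω) n) ρ ∧
    -- asymptotic normality
    TendstoInDistribution
      (fun (n : ℕ) ω => Real.sqrt n * (giniLinearCorrEst (fun i => Z i ω) n - ρ))
      atTop id (fun _ => P)
      (gaussianReal 0 (Real.toNNReal ((1 / giniLinkDeriv ρ) ^ 2 * giniAsympVar H))) := by
  obtain ⟨hσ, hρ⟩ := abs_lt_one_of_posDef hH.1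
  have hH2 : MemLp (fun z => ‖z‖) 2 H :=
    (memLp_two_iff_integrable_sq continuous_norm.aestronglyMeasurable).mpr hmom
  have hint : Integrable (fun z => ‖z‖) H := hH2.integrable (by norm_num)
  obtain ⟨h0, h1⟩ := hH.giniCov_pos hint
  have hcorr := hH.giniCorr_eq hint
  have hIF := hasInfluenceFunction_giniCorr hint h0 h1
  have hIFcov := hasInfluenceFunction_giniCov hint
  have hroot := isRootNConsistent_giniLinearCorrEst hH2 hlaw hindep hρ hcorr h0 h1
  have hmeas := aemeasurable_giniLinearCorrEst hlaw
  have hmem : ∀ n ω, giniLinearCorrEst (fun i => Z i ω) n ∈ Set.Icc (-1 : ℝ) 1 :=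
    fun n ω => giniLinearCorrEst_mem_Icc _ n
  refine ⟨bijOn_giniLink, fun n ω => sampleGiniCorr_mem_Icc _ n,
    ⟨hasDerivAt_giniLink hρ, (giniLinkDeriv_pos hρ).ne'⟩, ?_, ?_, ?_, ⟨h0, h1⟩, ⟨?_, ?_⟩, hroot, ?_⟩
  · rw [hIF.eq]
    exact ⟨hIF, memLp_giniCorrInfluence hH2⟩
  · intro a b
    rw [(hIFcov a b).eq]
    exact ⟨hIFcov a b, memLp_giniCovInfluence hH2 a b⟩
  · intro hρ0
    have h2 := hH.giniCov_ne_zero hint hρ0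
    refine ⟨h2, ?_⟩
    rw [giniAsympVar, hIF.eq, integral_giniCorrInfluence_sq hH2 h0 h1 h2, giniAsympVarExpansion]
    simp only [(hIFcov _ _).eq]
  · intro n
    refine Integrable.of_bound (hmeas n).aestronglyMeasurable 1 (ae_of_all _ fun ω => ?_)
    exact abs_le.mpr (hmem n ω)
  · refine hroot.tendsto_integral hmeas (B := 1 + |ρ|) fun n ω => ?_
    exact (abs_sub _ _).trans (by gcongr; exact abs_le.mpr (hmem n ω))
  · rw [giniAsympVar, hIF.eq]
    exact tendstoInDistribution_giniLinearCorrEst hH2 hlaw hindep hρ hcorr h0 h1
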